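/- Let $n\ge 1$ and let $T$ be a Calderón–Zygmund operator on $\mathbb R^n$, that is, a bounded linear operator on $L^2(\mathbb R^n)$ such that $Tf(x)=\int_{\mathbb R^n}K(x,y)f(y)\,dy$ for every $f\in L^2(\mathbb R^n)$ and almost every $x\notin\operatorname{supp}f$, where the kernel $K$ satisfies, for some constants $c_K$ and $0<\delta\le 1$, $|K(x,y)|\le c_K|x-y|^{-n}$ for $x\ne y$, and $$|K(x,y)-K(x',y)|+|K(y,x)-K(y,x')|\le c_K\frac{|x-x'|^{\delta}}{|x-y|^{n+\delta}}\quad\text{whenever } |x-x'|<|x-y|/2 .$$ (Functions and kernels may be real or complex valued.) Let $$T_\natural f(x)=\sup_{0<\varepsilon<\nu}\Big|\int_{\varepsilon<|x-y|<\nu}K(x,y)f(y)\,dy\Big| .$$ A general dyadic grid $\mathscr D$ is a collection of half-open cubes in $\mathbb R^n$ (with sides parallel to the axes) such that every $Q\in\mathscr D$ has sidelength $2^k$ for some $k\in\mathbb Z$; $Q\cap R\in\{Q,R,\emptyset\}$ for all $Q,R\in\mathscr D$; and for each $k\in\mathbb Z$ the cubes of sidelength $2^k$ in $\mathscr D$ partition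 $\mathbb R^n$. A family $\mathcal S=\{Q_j^k\}\subset\mathscr D$ $(k=0,1,2,\dots)$ is sparse if, with $\Omega_k=\bigcup_jQ_j^k$, for each $k$ the cubes $Q_j^k$ are pairwise disjoint in $j$, $\Omega_{k+1}\subset\Omega_k$, and $|\Omega_{k+1}\cap Q_j^k|\le\frac12|Q_j^k|$ for all $j$ (generations may be empty). For such $\mathscr D$ and $\mathcal S$ put $$\mathcal A_{\mathscr D,\mathcal S}g=\sum_{j,k}g_{Q_j^k}\chi_{Q_j^k},\qquad g_Q=\frac1{|Q|}\int_Qg\,dx .$$ Then there is a finite constant $c=c(T,n)$ such that for every $\sigma$-finite measure $\mu$ on $\mathbb R^n$ that is absolutely continuous with respect to Lebesgue measure (for example Lebesgue measure itself, or $w\,dx$ for a weight $w$), every Banach function space $X$ over $(\mathbb R^n,\mu)$ in the sense of Bennett and Sharpley, and every locally integrable function $f$ on $\mathbb R^n$, $$\|T_\natural f\|_X\le c\,\sup_{\mathscr D,\mathcal S}\big\|\mathcal A_{\mathscr D,\mathcal S}|f|\big\|_X ,$$ where the supremum is over all general dyadic grids $\mathscr D$ and all sparse families $\mathcal S\subset\mathscr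 D$, and both sides may be infinite. Here a Banach function space over $(\mathbb R^n,\mu)$ is given by a function norm $\rho$ on the $[0,\infty]$-valued measurable functions, with $\|f\|_X=\rho(|f|)$, such that: $\rho(f)=0$ iff $f=0$ $\mu$-a.e.; $\rho(af)=a\rho(f)$ for $0\le a<\infty$; $\rho(f+g)\le\rho(f)+\rho(g)$; $g\le f$ $\mu$-a.e. implies $\rho(g)\le\rho(f)$; $f_k\uparrow f$ $\mu$-a.e. implies $\rho(f_k)\uparrow\rho(f)$; and whenever $\mu(E)<\infty$, $\rho(\chi_E)<\infty$ and $\int_Ef\,d\mu\le C_E\,\rho(f)$ for all $f$ with a finite constant $C_E$. -/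

import Mathlib

open MeasureTheory Set
open scoped ENNReal NNReal

noncomputable section

/-- Euclidean space of dimension `n`. -/
abbrev RSpace (n : ℕ) : Type := EuclideanSpace ℝ (Fin n)

/-! ## Calderón-Zygmund operators -/

/-- `T` is an `L²` bounded Calderón-Zygmund operator on `ℝⁿ` with kernel `K`. The values of `K` on
the diagonal play no role; off the diagonal, the smoothness condition makes `K` continuous. -/
structure IsCalderonZygmund {𝕜 : Type*} [RCLike 𝕜] {n : ℕ}
    (T : Lp 𝕜 2 (volume : Measure (RSpace n)) →L[𝕜] Lp 𝕜 2 (volume : Measure (RSpace n)))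
    (K : RSpace n → RSpace n → 𝕜) : Prop where
  /-- `Tf(x) = ∫ K(x, y) f(y) dy` for almost every `x` outside the support of `f`. -/
  representation : ∀ (f : RSpace n → 𝕜) (hf : MemLp f 2 (volume : Measure (RSpace n))),
    ∀ᵐ x ∂(volume : Measure (RSpace n)), x ∉ tsupport f →
      T (hf.toLp f) x = ∫ y, K x y * f y
  growth : ∃ c : ℝ, ∀ x y, x ≠ y → ‖K x y‖ ≤ c / ‖x - y‖ ^ n
  smoothness : ∃ c δ : ℝ, 0 < δ ∧ δ ≤ 1 ∧ ∀ x x' y, ‖x - x'‖ < ‖x - y‖ / 2 →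
    ‖K x y - K x' y‖ + ‖K y x - K y x'‖ ≤ c * ‖x - x'‖ ^ δ / ‖x - y‖ ^ ((n : ℝ) + δ)

/-- The maximal truncated operator
`T_♮ f(x) = sup_{0 < ε < ν} |∫_{ε < |x - y| < ν} K(x, y) f(y) dy|`, with values in `[0, ∞]`. -/
def maximalTruncation {𝕜 : Type*} [RCLike 𝕜] {n : ℕ} (K : RSpace n → RSpace n → 𝕜)
    (f : RSpace n → 𝕜) (x : RSpace n) : ℝ≥0∞ :=
  ⨆ (ε : ℝ) (ν : ℝ) (_ : 0 < ε) (_ : ε < ν),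
    ‖∫ y in {y | ε < ‖x - y‖ ∧ ‖x - y‖ < ν}, K x y * f y‖ₑ

/-! ## Dyadic grids, sparse families and the dyadic positive operators -/

/-- `Q` is a half-open cube with sides of length `l` parallel to the coordinate axes. -/
def IsCube {n : ℕ} (l : ℝ) (Q : Set (RSpace n)) : Prop :=
  ∃ a : RSpace n, Q = {x | ∀ i, a i ≤ x i ∧ x i < a i + l}

/-- A general dyadic grid. -/
structure IsDyadicGrid {n : ℕ} (D : Set (Set (RSpace n))) : Prop where
  sidelength : ∀ Q ∈ D, ∃ k : ℤ, IsCube ((2 : ℝ) ^ k) Q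
  nested : ∀ Q ∈ D, ∀ R ∈ D, Q ∩ R = Q ∨ Q ∩ R = R ∨ Q ∩ R = ∅
  partition : ∀ k : ℤ, Setoid.IsPartition {Q | Q ∈ D ∧ IsCube ((2 : ℝ) ^ k) Q}

/-- `S` is a sparse family of cubes of `D`. Here `S k` is the `k`-th generation, the set of the
cubes `Q_j^k` for all `j`, and its union is `Ω_k`. Generations may be empty. -/
structure IsSparseFamily {n : ℕ} (D : Set (Set (RSpace n))) (S : ℕ → Set (Set (RSpace n))) :
    Prop where
  subset_grid : ∀ k, S k ⊆ D
  disjoint : ∀ k, (S k).PairwiseDisjoint id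
  nested : ∀ k, ⋃₀ S (k + 1) ⊆ ⋃₀ S k
  measure_le : ∀ k, ∀ Q ∈ S k, volume (⋃₀ S (k + 1) ∩ Q) ≤ volume Q / 2

/-- `𝒜_S g(x) = ∑_{j,k} g_{Q_j^k} χ_{Q_j^k}(x)` for `g` with values in `[0, ∞]`, where `g_Q` is the
average of `g` over `Q`. -/
def sparseOperator {n : ℕ} (S : ℕ → Set (Set (RSpace n))) (g : RSpace n → ℝ≥0∞)
    (x : RSpace n) : ℝ≥0∞ :=
  ∑' k : ℕ, ∑' Q : S k,
    (Q : Set (RSpace n)).indicator (fun _ => ⨍⁻ y in (Q : Set (RSpace n)), g y ∂volume) x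

/-! ## Banach function spaces -/

/-- A Banach function norm over a measure space `(α, μ)`, in the sense of Bennett and Sharpley.
The corresponding Banach function space `X` consists of the measurable `f` (modulo a.e. equality)
with `ρ(|f|) < ∞`, and `‖f‖_X = ρ(|f|)`. Only the values of the norm at measurable functions
matter. -/
structure BanachFunctionNorm {α : Type*} [MeasurableSpace α] (μ : Measure α) where
  /-- The norm of a measurable function with values in `[0, ∞]`. -/
  rho : (α → ℝ≥0∞) → ℝ≥0∞
  eq_zero_iff : ∀ f, Measurable f → (rho f = 0 ↔ f =ᵐ[μ] 0)
  const_mul : ∀ (a : ℝ≥0) (f), Measurable f → rho (fun x => a * f x) = a * rho f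
  add_le : ∀ f g, Measurable f → Measurable g → rho (fun x => f x + g x) ≤ rho f + rho g
  mono : ∀ f g, Measurable f → Measurable g → f ≤ᵐ[μ] g → rho f ≤ rho g
  /-- The Fatou property: `f_k ↑ f` a.e. implies `ρ(f_k) ↑ ρ(f)`. -/
  iSup_eq : ∀ f : ℕ → α → ℝ≥0∞, (∀ k, Measurable (f k)) →
    (∀ᵐ x ∂μ, Monotone fun k => f k x) → rho (fun x => ⨆ k, f k x) = ⨆ k, rho (f k)
  indicator_lt_top : ∀ E, MeasurableSet E → μ E < ∞ → rho (E.indicator fun _ => 1) < ∞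
  lintegral_le : ∀ E, MeasurableSet E → μ E < ∞ →
    ∃ C : ℝ≥0, ∀ f, Measurable f → ∫⁻ x in E, f x ∂μ ≤ C * rho f

end

/-!
The maximal truncated operator `T_♮` is dominated pointwise almost everywhere by finitely many
sparse operators, at least for truncations of bounded range; the inequality between the norms then
follows from the lattice property, the triangle inequality and the Fatou property.

*Weak type bounds.* Cotlar's argument compares a truncation at `x` with `T f - T (f 1_{B(x, t)})`
near `x`. Averaging its square over a small ball and using the boundedness of `T` on `L²` gives
`(T_♮ f)² ≤ C M(|T f|² + |f|²)` with the Hardy–Littlewood maximal function `M`, hence the weak type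
`(2, 2)` of `T_♮` (`exists_maximalTruncation_weak_two`). A Calderón–Zygmund decomposition on the
maximal dyadic cubes in `{M |f| > a}`, applied directly to `T_♮`, yields the weak type `(1, 1)`
(`exists_maximalTruncation_weak_one`): inside an annulus the bad part is handled by the smoothness
of the kernel, and the cubes that meet the boundary spheres are absorbed by the maximal function.

*Stopping cubes.* For a dyadic cube `Q`, the set of points of `Q` at which `T_♮ (f 1_{3Q})` or
`M (f 1_{3Q})` exceeds `L` times the average of `|f|` over `3Q` has measure at most `|Q| / 2` when
`L` is large. It is relatively open, hence the union of its maximal dyadic subcubes `P`, and the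
parent of each `P` contains a point where both functions are small. Therefore, on `P`,
`T_♮ (f 1_{3Q}) ≤ C |f|_{3Q} + T_♮ (f 1_{3P})` (`exists_maximalTruncation_child_le`). Iterating,
`T_♮ (f 1_{3Q}) ≤ C ∑ |f|_{3P} χ_P` almost everywhere on `Q`, the sum being over all stopping cubes
(`exists_ae_maximalTruncation_le`). Truncations with outer radius at most the sidelength of `Q` see
only `f 1_{3Q}` on `Q`, so this covers all truncations of bounded range of a locally integrable `f`.

*Back to dyadic grids.* The base cubes have sidelengths `2 ^ k / 3`, so that by the one-third trick
their triples are distributed over `3 ^ n` dyadic grids (`isDyadicGrid_grid`). Within each grid, the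
triples of the stopping cubes satisfy a Carleson packing condition. Colouring them by the number of
their ancestors modulo a large integer splits them into boundedly many sparse families
(`isSparseFamily_levelClass`).
-/

namespace SparseDomination

/-! ### Dyadic cubes, their triples and the adjacent dyadic grids -/

/-- Index set of the base lattice: a pair `(k, m)` stands for the cube of sidelength `2 ^ k / 3`
with lower corner `(2 ^ k / 3) m`. -/
abbrev DyadicIndex (n : ℕ) : Type := ℤ × (Fin n → ℤ)

/-- The sidelength `2 ^ k / 3` of the base cubes of generation `k`. The factor `1 / 3` makes the
triples of base cubes have sidelength `2 ^ k`. -/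
noncomputable def side (k : ℤ) : ℝ := 2 ^ k / 3

/-- The base cube with index `i`. -/
def cube {n : ℕ} (i : DyadicIndex n) : Set (RSpace n) :=
  {x | ∀ c, side i.1 * i.2 c ≤ x c ∧ x c < side i.1 * (i.2 c + 1)}

/-- The cube concentric with `cube i` and three times as large. -/
def triple {n : ℕ} (i : DyadicIndex n) : Set (RSpace n) :=
  {x | ∀ c, side i.1 * (i.2 c - 1) ≤ x c ∧ x c < side i.1 * (i.2 c + 2)}

/-- The index of the base cube of the next larger generation that contains `cube i`. -/
def parent {n : ℕ} (i : DyadicIndex n) : DyadicIndex n := (i.1 + 1, fun c => i.2 c / 2)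

/-- The index of the base cube of generation `k` that contains `x`. -/
noncomputable def indexAt {n : ℕ} (k : ℤ) (x : RSpace n) : DyadicIndex n :=
  (k, fun c => ⌊x c / side k⌋)

/-- The lower corner of `cube i`. -/
noncomputable def corner {n : ℕ} (i : DyadicIndex n) : RSpace n :=
  WithLp.toLp 2 fun c => side i.1 * i.2 c

lemma side_pos (k : ℤ) : 0 < side k := by unfold side; positivity

lemma side_succ (k : ℤ) : side (k + 1) = 2 * side k := by
  unfold side; rw [zpow_add_one₀ two_ne_zero]; ring

lemma side_mono {k l : ℤ} (h : k ≤ l) : side k ≤ side l := by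
  unfold side; gcongr; norm_num

variable {n : ℕ}

lemma mem_cube_iff {i : DyadicIndex n} {x : RSpace n} : x ∈ cube i ↔ indexAt i.1 x = i := by
  have h := side_pos i.1
  simp only [cube, indexAt, mem_ofPred_eq, Prod.ext_iff, funext_iff, true_and, Int.floor_eq_iff,
    le_div_iff₀ h, div_lt_iff₀ h, mul_comm (side i.1)]

lemma mem_cube_indexAt (k : ℤ) (x : RSpace n) : x ∈ cube (indexAt k x) := mem_cube_iff.2 rfl

lemma parent_indexAt (k : ℤ) (x : RSpace n) : parent (indexAt k x) = indexAt (k + 1) x := by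
  simp only [parent, indexAt, Prod.mk.injEq, true_and, side_succ]
  funext c
  have := Int.floor_div_natCast (x c / side k) 2
  rw [Nat.cast_ofNat, Nat.cast_ofNat, div_div, mul_comm] at this
  exact this.symm

lemma indexAt_eq_of_le {k l : ℤ} (h : k ≤ l) {x y : RSpace n} (hxy : indexAt k x = indexAt k y) :
    indexAt l x = indexAt l y := by
  induction l, h using Int.leInduction with
  | base => exact hxy
  | succ l _ ih => rw [← parent_indexAt, ← parent_indexAt, ih]

lemma cube_subset_of_le {i j : DyadicIndex n} (h : i.1 ≤ j.1) {x : RSpace n} (hi : x ∈ cube i)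
    (hj : x ∈ cube j) : cube i ⊆ cube j := by
  intro y hy
  rw [mem_cube_iff] at *
  rw [← hj]
  apply indexAt_eq_of_le h
  rw [hi, hy]

lemma eq_of_mem_cube {i j : DyadicIndex n} (h : i.1 = j.1) {x : RSpace n} (hi : x ∈ cube i)
    (hj : x ∈ cube j) : i = j := by
  rw [mem_cube_iff] at hi hj
  rw [← hi, ← hj, h]

lemma corner_mem (i : DyadicIndex n) : corner i ∈ cube i := by
  intro c
  have := side_pos i.1
  simp only [corner]
  constructor <;> nlinarith

lemma cube_subset_parent (i : DyadicIndex n) : cube i ⊆ cube (parent i) := by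
  intro x hx
  rw [mem_cube_iff] at hx
  rw [← hx, parent_indexAt]
  exact mem_cube_indexAt _ _

lemma cube_subset_triple (i : DyadicIndex n) : cube i ⊆ triple i := by
  intro x hx c
  have := side_pos i.1
  have := hx c
  constructor <;> nlinarith

/-- Translations by at most one sidelength in each coordinate sweep out the triple of a cube. -/
lemma mem_triple_iff {i : DyadicIndex n} {y : RSpace n} :
    y ∈ triple i ↔ ∃ x ∈ cube i, ∀ c, |x c - y c| ≤ side i.1 := by
  have hs := side_pos i.1
  constructor
  · intro hy
    have : ∀ c, ∃ t, (side i.1 * i.2 c ≤ t ∧ t < side i.1 * (i.2 c + 1)) ∧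
        |t - y c| ≤ side i.1 := by
      intro c
      have := hy c
      rcases lt_or_ge (y c) (side i.1 * i.2 c) with h | h
      · refine ⟨y c + side i.1, ⟨?_, ?_⟩, ?_⟩
        · nlinarith
        · nlinarith
        · simp [abs_of_pos hs]
      rcases lt_or_ge (y c) (side i.1 * (i.2 c + 1)) with h' | h'
      · exact ⟨y c, ⟨h, h'⟩, by simp [hs.le]⟩
      · refine ⟨y c - side i.1, ⟨?_, ?_⟩, ?_⟩
        · nlinarith
        · nlinarith
        · simp [abs_of_pos hs]
    choose t ht ht' using this
    exact ⟨WithLp.toLp 2 t, ht, ht'⟩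
  · rintro ⟨x, hx, h⟩ c
    have h1 := hx c
    have h2 := abs_le.1 (h c)
    constructor <;> nlinarith

lemma triple_subset_of_cube_subset {i j : DyadicIndex n} (h : i.1 ≤ j.1) (hij : cube i ⊆ cube j) :
    triple i ⊆ triple j := by
  intro y hy
  obtain ⟨x, hx, hxy⟩ := mem_triple_iff.1 hy
  exact mem_triple_iff.2 ⟨x, hij hx, fun c => (hxy c).trans (side_mono h)⟩

/-! ### Sizes of cubes -/

lemma norm_sub_le_of_forall {x y : RSpace n} {s : ℝ} (hs : 0 ≤ s) (h : ∀ c, |x c - y c| ≤ s) :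
    ‖x - y‖ ≤ √n * s := by
  rw [EuclideanSpace.norm_eq]
  calc √(∑ c, ‖(x - y) c‖ ^ 2) ≤ √(∑ _c : Fin n, s ^ 2) := by
        gcongr with c
        simpa using h c
    _ = √n * s := by simp [Real.sqrt_sq hs]

lemma norm_sub_le_of_mem_cube {i : DyadicIndex n} {x y : RSpace n} (hx : x ∈ cube i)
    (hy : y ∈ cube i) : ‖x - y‖ ≤ √n * side i.1 := by
  refine norm_sub_le_of_forall (side_pos _).le fun c => abs_le.2 ?_
  have := hx c
  have := hy c
  constructor <;> nlinarith

lemma norm_sub_le_of_mem_triple {i : DyadicIndex n} {x y : RSpace n} (hx : x ∈ cube i)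
    (hy : y ∈ triple i) : ‖x - y‖ ≤ √n * (2 * side i.1) := by
  have hs := side_pos i.1
  refine norm_sub_le_of_forall (by positivity) fun c => abs_le.2 ?_
  have := hx c
  have := hy c
  constructor <;> nlinarith

lemma mem_triple_of_norm_lt {i : DyadicIndex n} {x y : RSpace n} (hx : x ∈ cube i)
    (h : ‖x - y‖ < side i.1) : y ∈ triple i :=
  mem_triple_iff.2 ⟨x, hx, fun c => by
    simpa using (PiLp.norm_apply_le (x - y) c).trans h.le⟩

/-- The half-open cube with lower corner `a` and sidelength `l`. -/
def box (a : Fin n → ℝ) (l : ℝ) : Set (RSpace n) := {x | ∀ c, a c ≤ x c ∧ x c < a c + l}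

lemma box_eq_preimage (a : Fin n → ℝ) (l : ℝ) :
    box a l =
      (WithLp.ofLp : RSpace n → (Fin n → ℝ)) ⁻¹' (univ.pi fun c => Ico (a c) (a c + l)) := by
  ext x; simp [box]

lemma measurableSet_box (a : Fin n → ℝ) (l : ℝ) : MeasurableSet (box a l) := by
  rw [box_eq_preimage]
  exact (PiLp.volume_preserving_ofLp (Fin n)).measurable
    (MeasurableSet.univ_pi fun _ => measurableSet_Ico)

lemma volume_box (a : Fin n → ℝ) (l : ℝ) : volume (box a l) = ENNReal.ofReal l ^ n := by
  rw [box_eq_preimage, (PiLp.volume_preserving_ofLp (Fin n)).measure_preimage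
    (MeasurableSet.univ_pi fun _ => measurableSet_Ico).nullMeasurableSet, volume_pi_pi]
  simp

lemma cube_eq_box (i : DyadicIndex n) : cube i = box (fun c => side i.1 * i.2 c) (side i.1) := by
  simp [cube, box, mul_add]

lemma triple_eq_box (i : DyadicIndex n) :
    triple i = box (fun c => side i.1 * (i.2 c - 1)) (2 ^ i.1) := by
  have : ∀ m : ℝ, side i.1 * (m + 2) = side i.1 * (m - 1) + 2 ^ i.1 := by
    intro m; unfold side; ring
  simp [triple, box, this]

lemma measurableSet_cube (i : DyadicIndex n) : MeasurableSet (cube i) := by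
  rw [cube_eq_box]; exact measurableSet_box _ _

lemma measurableSet_triple (i : DyadicIndex n) : MeasurableSet (triple i) := by
  rw [triple_eq_box]; exact measurableSet_box _ _

lemma volume_cube (i : DyadicIndex n) : volume (cube i) = ENNReal.ofReal (side i.1) ^ n := by
  rw [cube_eq_box, volume_box]

lemma volume_triple (i : DyadicIndex n) : volume (triple i) = 3 ^ n * volume (cube i) := by
  rw [triple_eq_box, volume_box, volume_cube, ← mul_pow, side, ENNReal.ofReal_div_of_pos (by simp)]
  congr 1
  rw [ENNReal.ofReal_ofNat, ENNReal.mul_div_cancel] <;> simp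

lemma volume_cube_pos (i : DyadicIndex n) : volume (cube i) ≠ 0 := by
  rw [volume_cube]; simp [side_pos]

lemma volume_cube_ne_top (i : DyadicIndex n) : volume (cube i) ≠ ∞ := by
  rw [volume_cube]; finiteness

lemma volume_triple_pos (i : DyadicIndex n) : volume (triple i) ≠ 0 := by
  rw [volume_triple]; simp [volume_cube_pos]

lemma volume_triple_ne_top (i : DyadicIndex n) : volume (triple i) ≠ ∞ := by
  rw [volume_triple]; exact ENNReal.mul_ne_top (by finiteness) (volume_cube_ne_top i)

/-! ### Decomposition of a set into maximal dyadic cubes -/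

/-- The maximal base cubes contained in `U`. -/
def maximalCubes (U : Set (RSpace n)) : Set (DyadicIndex n) :=
  {i | cube i ⊆ U ∧ ¬ cube (parent i) ⊆ U}

lemma eq_of_mem_maximalCubes {U : Set (RSpace n)} {i j : DyadicIndex n}
    (hi : i ∈ maximalCubes U) (hj : j ∈ maximalCubes U) {x : RSpace n} (hxi : x ∈ cube i)
    (hxj : x ∈ cube j) : i = j := by
  wlog h : i.1 ≤ j.1 generalizing i j
  · exact (this hj hi hxj hxi (le_of_not_ge h)).symm
  rcases h.eq_or_lt with h | h
  · exact eq_of_mem_cube h hxi hxj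
  · exact (hi.2 ((cube_subset_of_le (Int.add_one_le_iff.2 h) (cube_subset_parent i hxi) hxj).trans
      hj.1)).elim

lemma exists_volume_lt_cube (hn : 1 ≤ n) {v : ℝ≥0∞} (hv : v ≠ ∞) :
    ∃ k : ℤ, ∀ i : DyadicIndex n, k ≤ i.1 → v < volume (cube i) := by
  obtain ⟨m, hm⟩ := pow_unbounded_of_one_lt (3 * (v.toReal + 1)) (one_lt_two : (1 : ℝ) < 2)
  refine ⟨m, fun i hi => ?_⟩
  have h1 : v.toReal + 1 ≤ side i.1 := by
    have h := side_mono hi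
    have : side (m : ℤ) = 2 ^ m / 3 := by simp [side]
    linarith
  have h0 := v.toReal_nonneg
  rw [volume_cube, ← ENNReal.ofReal_toReal hv, ← ENNReal.ofReal_pow (side_pos _).le]
  apply (ENNReal.ofReal_lt_ofReal_iff (by have := side_pos i.1; positivity)).2
  calc v.toReal < side i.1 := by linarith
    _ ≤ side i.1 ^ n := le_self_pow₀ (by linarith) (by lia)

/-- A set of finite measure all of whose points have a base cube in the set is the union of its
maximal cubes: finite measure bounds the sidelengths, so that increasing chains stop. -/
lemma biUnion_maximalCubes (hn : 1 ≤ n) {U : Set (RSpace n)} (hU : volume U ≠ ∞)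
    (h : ∀ x ∈ U, ∃ k, cube (indexAt k x) ⊆ U) : ⋃ i ∈ maximalCubes U, cube i = U := by
  apply subset_antisymm (iUnion₂_subset fun i hi => hi.1)
  intro x hx
  obtain ⟨K, hK⟩ := exists_volume_lt_cube hn hU
  obtain ⟨k, hk, hmax⟩ := Int.exists_greatest_of_bdd (P := fun k => cube (indexAt k x) ⊆ U)
    ⟨K, fun k hk => by
      by_contra! hlt
      exact (hK (indexAt k x) hlt.le).not_ge (measure_mono hk)⟩ (h x hx)
  refine mem_biUnion (x := indexAt k x) ⟨hk, fun hp => ?_⟩ (mem_cube_indexAt k x)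
  rw [parent_indexAt] at hp
  have := hmax _ hp
  lia

/-- Small base cubes around a point of an open set are contained in it. -/
lemma exists_cube_subset_of_isOpen {U : Set (RSpace n)} (hU : IsOpen U) {x : RSpace n}
    (hx : x ∈ U) (l : ℤ) : ∃ k ≤ l, cube (indexAt k x) ⊆ U := by
  obtain ⟨ε, hε, hball⟩ := Metric.isOpen_iff.1 hU x hx
  obtain ⟨m, hm⟩ := exists_pow_lt_of_lt_one (show 0 < ε / (√n * side l + 1) by
    have := side_pos l; positivity) (show (1 / 2 : ℝ) < 1 by norm_num)
  have hside : side (l - m) = side l * (1 / 2) ^ m := by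
    unfold side
    rw [zpow_sub₀ two_ne_zero]
    simp [div_eq_mul_inv]; ring
  refine ⟨l - m, by lia, fun y hy => hball ?_⟩
  have h1 := norm_sub_le_of_mem_cube hy (mem_cube_indexAt _ x)
  have hl := side_pos l
  rw [lt_div_iff₀ (by positivity)] at hm
  have h2 : side ((indexAt (l - m) x).1) = side l * (1 / 2) ^ m := hside
  rw [h2] at h1
  rw [mem_ball_iff_norm]
  have : (0 : ℝ) < (1 / 2) ^ m := by positivity
  nlinarith

/-! ### The adjacent dyadic grids -/

/-- The triples of the base cubes whose indices lie in the residue class modulo `3` determined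
by `j`, which changes sign from one generation to the next because `2 = -1` modulo `3`. Every
triple of a base cube belongs to exactly one of the `3 ^ n` grids with `0 ≤ j c < 3`. -/
def residueClass (j : Fin n → Fin 3) : Set (DyadicIndex n) :=
  {i | ∀ c, (3 : ℤ) ∣ i.2 c - 1 - i.1.negOnePow * (j c : ℤ)}

/-- The dyadic grid of the triples of the base cubes in a residue class. -/
def grid (j : Fin n → Fin 3) : Set (Set (RSpace n)) := triple '' residueClass j

lemma exists_mem_residueClass (i : DyadicIndex n) : ∃ j : Fin n → Fin 3, i ∈ residueClass j := by
  have : ∀ c, ∃ j : Fin 3, (3 : ℤ) ∣ i.2 c - 1 - i.1.negOnePow * (j : ℤ) := by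
    intro c
    have h3 : (3 : ℤ) ∣ i.2 c - 1 ∨ (3 : ℤ) ∣ i.2 c - 1 - 1 ∨ (3 : ℤ) ∣ i.2 c - 1 - 2 := by lia
    rcases Int.units_eq_one_or i.1.negOnePow with h | h <;> rw [h]
    · rcases h3 with h | h | h
      · exact ⟨0, by simpa using h⟩
      · exact ⟨1, by simpa using h⟩
      · exact ⟨2, by simpa using h⟩
    · rcases h3 with h | h | h
      · exact ⟨0, by simpa using h⟩
      · exact ⟨2, by simp; lia⟩
      · exact ⟨1, by simp; lia⟩
  choose j hj using this
  exact ⟨j, hj⟩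

lemma side_add_nat (k : ℤ) (d : ℕ) : side (k + d) = side k * 2 ^ d := by
  unfold side
  rw [zpow_add₀ two_ne_zero, zpow_natCast]; ring

/-- Within one residue class, the lower corners of the triples of two generations are congruent
modulo `3` in units of the smaller `side`, so intersecting triples are nested. -/
lemma triple_subset_of_mem {j : Fin n → Fin 3} {i i' : DyadicIndex n} (hi : i ∈ residueClass j)
    (hi' : i' ∈ residueClass j) (hle : i.1 ≤ i'.1) {x : RSpace n} (hx : x ∈ triple i)
    (hx' : x ∈ triple i') : triple i ⊆ triple i' := by
  obtain ⟨d, hd⟩ := Int.le.dest hle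
  have hs := side_pos i.1
  -- `2 ^ e = (-1) ^ e` modulo `3`, which is why the residues change sign.
  have hmod : ∀ e : ℕ, (3 : ℤ) ∣ 2 ^ e - Int.negOnePow e := by
    intro e
    induction e with
    | zero => simp
    | succ e ih =>
      push_cast
      rw [Int.negOnePow_succ, pow_succ]
      push_cast
      lia
  intro y hy c
  have hxc := hx c
  have hxc' := hx' c
  have hyc := hy c
  rw [← hd, side_add_nat] at hxc' ⊢
  -- Everything is compared in units of `side i.1`.
  have e1 : (i.2 c : ℝ) - 1 < 2 ^ d * (i'.2 c + 2) := by
    have := hxc.1.trans_lt hxc'.2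
    rw [mul_assoc] at this
    exact lt_of_mul_lt_mul_left this hs.le
  have e2 : (2 : ℝ) ^ d * (i'.2 c - 1) < i.2 c + 2 := by
    have := hxc'.1.trans_lt hxc.2
    rw [mul_assoc] at this
    exact lt_of_mul_lt_mul_left this hs.le
  have e1' : i.2 c - 1 < 2 ^ d * (i'.2 c - 1) + 3 * 2 ^ d := by
    have : (i.2 c : ℤ) - 1 < 2 ^ d * (i'.2 c + 2) := by exact_mod_cast e1
    linarith
  have e2' : 2 ^ d * (i'.2 c - 1) < i.2 c - 1 + 3 := by
    have : (2 : ℤ) ^ d * (i'.2 c - 1) < i.2 c + 2 := by exact_mod_cast e2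
    linarith
  have e3 : (3 : ℤ) ∣ (i.2 c - 1) - 2 ^ d * (i'.2 c - 1) := by
    have h1 := hi c
    have h2 := hi' c
    have hsgn : ((Int.negOnePow d : ℤˣ) : ℤ) * Int.negOnePow d = 1 := by
      rw [← Units.val_mul, Int.units_mul_self]; simp
    rw [← hd, Int.negOnePow_add, Units.val_mul] at h2
    obtain ⟨a, ha⟩ := h1
    obtain ⟨b, hb⟩ := h2
    obtain ⟨e, he⟩ := hmod d
    refine ⟨a - Int.negOnePow d * b - e * (i'.2 c - 1), ?_⟩
    linear_combination ha - (Int.negOnePow d : ℤ) * hb - (i'.2 c - 1) * he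
      - (i.1.negOnePow : ℤ) * (j c : ℤ) * hsgn
  have e4 : 2 ^ d * (i'.2 c - 1) ≤ i.2 c - 1 := by lia
  have e5 : i.2 c - 1 + 3 ≤ 2 ^ d * (i'.2 c - 1) + 3 * 2 ^ d := by
    obtain ⟨a, ha⟩ := e3
    generalize (2 : ℤ) ^ d * (i'.2 c - 1) = u at *
    generalize (2 : ℤ) ^ d = w at *
    lia
  have e4' : (2 : ℝ) ^ d * (i'.2 c - 1) ≤ i.2 c - 1 := by exact_mod_cast e4
  have e5' : (i.2 c : ℝ) + 2 ≤ 2 ^ d * (i'.2 c + 2) := by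
    have : i.2 c + 2 ≤ 2 ^ d * (i'.2 c + 2) := by linarith
    exact_mod_cast this
  constructor
  · refine le_trans ?_ hyc.1
    rw [mul_assoc]; gcongr
  · refine hyc.2.trans_le ?_
    rw [mul_assoc]; gcongr

lemma isCube_triple (i : DyadicIndex n) : IsCube ((2 : ℝ) ^ i.1) (triple i) :=
  ⟨WithLp.toLp 2 fun c => side i.1 * (i.2 c - 1), triple_eq_box i⟩

lemma isCube_unique (hn : 1 ≤ n) {Q : Set (RSpace n)} {k l : ℤ} (hk : IsCube ((2 : ℝ) ^ k) Q)
    (hl : IsCube ((2 : ℝ) ^ l) Q) : k = l := by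
  obtain ⟨a, rfl⟩ := hk
  obtain ⟨b, hb⟩ := hl
  have h : volume (box a ((2 : ℝ) ^ k)) = volume (box b ((2 : ℝ) ^ l)) := congrArg _ hb
  rw [volume_box, volume_box] at h
  have h' := (ENNReal.pow_right_strictMono (n := n) (by lia)).injective h
  rw [ENNReal.ofReal_eq_ofReal_iff (by positivity) (by positivity)] at h'
  exact zpow_right_injective₀ (by norm_num) (by norm_num) h'

lemma triple_nonempty (i : DyadicIndex n) : (triple i).Nonempty :=
  ⟨_, cube_subset_triple i (corner_mem i)⟩

/-- The one-third trick: `grid j` is a dyadic grid. -/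
lemma isDyadicGrid_grid (hn : 1 ≤ n) (j : Fin n → Fin 3) : IsDyadicGrid (grid j) where
  sidelength := by
    rintro _ ⟨i, _, rfl⟩
    exact ⟨i.1, isCube_triple i⟩
  nested := by
    rintro _ ⟨i, hi, rfl⟩ _ ⟨i', hi', rfl⟩
    rcases (triple i ∩ triple i').eq_empty_or_nonempty with h | ⟨x, hx, hx'⟩
    · exact .inr (.inr h)
    rcases le_total i.1 i'.1 with h | h
    · exact .inl (inter_eq_left.2 (triple_subset_of_mem hi hi' h hx hx'))
    · exact .inr (.inl (inter_eq_right.2 (triple_subset_of_mem hi' hi h hx' hx)))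
  partition := by
    intro k
    refine ⟨?_, fun x => ?_⟩
    · rintro ⟨⟨i, _, h⟩, _⟩
      exact (triple_nonempty i).ne_empty h
    have hs := side_pos k
    let r : Fin n → ℤ := fun c => k.negOnePow * (j c : ℤ)
    let i : DyadicIndex n := (k, fun c => 3 * ⌊(x c / side k - r c) / 3⌋ + r c + 1)
    have hi : i ∈ residueClass j := fun c => ⟨⌊(x c / side k - r c) / 3⌋, by simp [i, r]⟩
    have hx : x ∈ triple i := by
      intro c
      have h1 := Int.floor_le ((x c / side k - r c) / 3)
      have h2 := Int.lt_floor_add_one ((x c / side k - r c) / 3)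
      set m := ⌊(x c / side k - r c) / 3⌋ with hm
      have e : x c = side k * (x c / side k) := by field_simp
      simp only [i, ← hm]
      push_cast
      constructor
      · rw [e]; gcongr; linarith
      · rw [e]; gcongr; linarith
    refine ⟨triple i, ⟨⟨⟨i, hi, rfl⟩, isCube_triple i⟩, hx⟩, ?_⟩
    rintro _ ⟨⟨⟨i', hi', rfl⟩, hc⟩, hx'⟩
    have hk : i'.1 = k := isCube_unique hn (isCube_triple i') hc
    exact subset_antisymm (triple_subset_of_mem hi' hi hk.le hx' hx)
      (triple_subset_of_mem hi hi' hk.ge hx hx')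

lemma triple_injective (hn : 1 ≤ n) : Function.Injective (triple (n := n)) := by
  intro i i' h
  have hk : i.1 = i'.1 := isCube_unique hn (isCube_triple i) (h ▸ isCube_triple i')
  have hsub : ∀ {i i' : DyadicIndex n}, i.1 = i'.1 → triple i ⊆ triple i' →
      ∀ c, i'.2 c ≤ i.2 c := by
    intro i i' hk h c
    have hs := side_pos i.1
    have hmem : (WithLp.toLp 2 fun c => side i.1 * (i.2 c - 1) : RSpace n) ∈ triple i := by
      intro c
      constructor
      · exact le_rfl
      · show side i.1 * ((i.2 c : ℝ) - 1) < _
        gcongr; linarith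
    have := (h hmem c).1
    rw [← hk] at this
    have := le_of_mul_le_mul_left this hs
    exact_mod_cast (by linarith : (i'.2 c : ℝ) ≤ i.2 c)
  exact Prod.ext hk (funext fun c => le_antisymm (hsub hk.symm h.ge c) (hsub hk h.le c))

/-! ### Carleson families and sparse families -/

lemma nonempty_of_mem_grid {D : Set (Set (RSpace n))} (hD : IsDyadicGrid D) {Q : Set (RSpace n)}
    (hQ : Q ∈ D) : Q.Nonempty := by
  obtain ⟨k, a, rfl⟩ := hD.sidelength Q hQ
  have : (0 : ℝ) < 2 ^ k := by positivity
  exact ⟨a, fun i => ⟨le_rfl, by linarith⟩⟩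

/-- The members of `F` that strictly contain `R`. -/
def strictAncestors {α : Type*} (F : Set (Set α)) (R : Set α) : Set (Set α) := {P | P ∈ F ∧ R ⊂ P}

/-- The number of members of `F` that strictly contain `R`. -/
noncomputable def level {α : Type*} (F : Set (Set α)) (R : Set α) : ℕ := (strictAncestors F R).ncard

section Level

variable {D F : Set (Set (RSpace n))}

lemma subset_or_subset_of_mem (hD : IsDyadicGrid D) {P R : Set (RSpace n)} (hP : P ∈ D)
    (hR : R ∈ D) {x : RSpace n} (hxP : x ∈ P) (hxR : x ∈ R) : P ⊆ R ∨ R ⊆ P := by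
  rcases hD.nested P hP R hR with h | h | h
  · exact .inl (inter_eq_left.1 h)
  · exact .inr (inter_eq_right.1 h)
  · exact (notMem_empty x (h ▸ ⟨hxP, hxR⟩)).elim

lemma level_lt_level {P R : Set (RSpace n)} (hfin : (strictAncestors F R).Finite) (hP : P ∈ F)
    (h : R ⊂ P) : level F P < level F R :=
  ncard_lt_ncard ⟨fun _ hS => ⟨hS.1, h.trans hS.2⟩, fun hsub => (hsub ⟨hP, h⟩).2.ne rfl⟩ hfin

lemma eq_of_level_eq (hD : IsDyadicGrid D) (hF : F ⊆ D)
    (hfin : ∀ R ∈ F, (strictAncestors F R).Finite) {P R : Set (RSpace n)} (hP : P ∈ F) (hR : R ∈ F)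
    (hl : level F P = level F R) {x : RSpace n} (hxP : x ∈ P) (hxR : x ∈ R) : P = R := by
  by_contra hne
  rcases subset_or_subset_of_mem hD (hF hP) (hF hR) hxP hxR with h | h
  · exact (level_lt_level (hfin P hP) hR (h.ssubset_of_ne hne)).ne hl.symm
  · exact (level_lt_level (hfin R hR) hP (h.ssubset_of_ne (Ne.symm hne))).ne hl

/-- Levels have no gaps. -/
lemma exists_superset_level_eq (hD : IsDyadicGrid D) (hF : F ⊆ D)
    (hfin : ∀ R ∈ F, (strictAncestors F R).Finite) {p : ℕ} {R : Set (RSpace n)} (hR : R ∈ F)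
    (hp : p ≤ level F R) : ∃ P ∈ F, R ⊆ P ∧ level F P = p := by
  induction h : level F R using Nat.strong_induction_on generalizing R with
  | _ l ih =>
    subst h
    rcases hp.eq_or_lt with h | hlt
    · exact ⟨R, hR, Subset.rfl, h.symm⟩
    have hne : (strictAncestors F R).Nonempty := by
      rw [← ncard_pos (hfin R hR)]
      exact (Nat.zero_le p).trans_lt hlt
    obtain ⟨P, hP, hmin⟩ := (hfin R hR).exists_minimal hne
    have hsub : strictAncestors F R ⊆ insert P (strictAncestors F P) := by
      intro S hS
      obtain ⟨x, hx⟩ := nonempty_of_mem_grid hD (hF hR)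
      rcases subset_or_subset_of_mem hD (hF hS.1) (hF hP.1) (hS.2.subset hx) (hP.2.subset hx)
        with h | h
      · exact .inl (h.antisymm (hmin hS h))
      · exact (eq_or_ne S P).imp id fun hne => ⟨hS.1, h.ssubset_of_ne hne.symm⟩
    have h1 : level F R ≤ level F P + 1 :=
      (ncard_le_ncard hsub ((hfin P hP.1).insert P)).trans (ncard_insert_le _ _)
    obtain ⟨S, hS, hPS, hSp⟩ := ih _ (level_lt_level (hfin R hR) hP.1 hP.2) hP.1 (by lia) rfl
    exact ⟨S, hS, hP.2.subset.trans hPS, hSp⟩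

/-- The members of `F` whose level is `r + t m`, for `t = 0, 1, 2, …`. -/
def levelClass (F : Set (Set (RSpace n))) (m r t : ℕ) : Set (Set (RSpace n)) :=
  {R | R ∈ F ∧ level F R = r + t * m}

/-- A point in a cube of level `l + m` inside a cube `R` of level `l` lies in at least `m`
subcubes of `R` of the family, so the Carleson condition bounds the measure of the set of such
points by `|R| / 2`. -/
lemma isSparseFamily_levelClass (hD : IsDyadicGrid D) (hF : F ⊆ D)
    (hcount : F.Countable) (hmeas : ∀ R ∈ F, MeasurableSet R)
    (hfin : ∀ R ∈ F, (strictAncestors F R).Finite) {m : ℕ} (hm : 0 < m)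
    (hcarl : ∀ R ∈ F, 2 * ∑' P : {P | P ∈ F ∧ P ⊆ R}, volume (P : Set (RSpace n)) ≤ m * volume R)
    (r : ℕ) : IsSparseFamily D (levelClass F m r) where
  subset_grid t R hR := hF hR.1
  disjoint t P hP R hR hne := by
    rw [Function.onFun, disjoint_left]
    exact fun x hxP hxR => hne
      (eq_of_level_eq hD hF hfin hP.1 hR.1 (hP.2.trans hR.2.symm) hxP hxR)
  nested t := by
    rintro x ⟨R, hR, hx⟩
    obtain ⟨P, hP, hRP, hl⟩ := exists_superset_level_eq hD hF hfin (p := r + t * m) hR.1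
      (by rw [hR.2]; gcongr; lia)
    exact ⟨P, ⟨hP, hl⟩, hRP hx⟩
  measure_le t R hR := by
    set V := ⋃₀ levelClass F m r (t + 1) ∩ R
    have hc : ({P | P ∈ F ∧ P ⊆ R}).Countable := hcount.mono fun _ h => h.1
    have : Countable {P | P ∈ F ∧ P ⊆ R} := hc
    have hpt : ∀ x ∈ V, (m : ℝ≥0∞) ≤
        ∑' P : {P | P ∈ F ∧ P ⊆ R}, (P : Set (RSpace n)).indicator (fun _ => (1 : ℝ≥0∞)) x := by
      rintro x ⟨⟨Q, hQ, hxQ⟩, hxR⟩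
      have hlev : level F Q = level F R + m := by rw [hQ.2, hR.2]; ring
      have hQR : Q ⊆ R := by
        rcases subset_or_subset_of_mem hD (hF hQ.1) (hF hR.1) hxQ hxR with h | h
        · exact h
        · rcases eq_or_ne Q R with rfl | hne
          · exact h
          · have := level_lt_level (hfin R hR.1) hQ.1 (h.ssubset_of_ne hne.symm)
            lia
      have hsub : strictAncestors F Q ⊆
          {P | (P ∈ F ∧ P ⊆ R) ∧ Q ⊂ P} ∪ strictAncestors F R := by
        intro P hP
        rcases subset_or_subset_of_mem hD (hF hP.1) (hF hR.1) (hP.2.subset hxQ) hxR with h | h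
        · exact .inl ⟨⟨hP.1, h⟩, hP.2⟩
        · rcases eq_or_ne P R with rfl | hne
          · exact .inl ⟨⟨hP.1, Subset.rfl⟩, hP.2⟩
          · exact .inr ⟨hP.1, h.ssubset_of_ne hne.symm⟩
      have hfin' : {P | (P ∈ F ∧ P ⊆ R) ∧ Q ⊂ P}.Finite :=
        (hfin Q hQ.1).subset fun P hP => ⟨hP.1.1, hP.2⟩
      have hcard : m ≤ hfin'.toFinset.card := by
        have h1 := (ncard_le_ncard hsub (hfin'.union (hfin R hR.1))).trans (ncard_union_le _ _)
        rw [ncard_eq_toFinset_card _ hfin'] at h1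
        change level F Q ≤ _ + level F R at h1
        exact le_of_add_le_add_right (hlev.symm.trans_le h1 |>.trans' (by rw [add_comm]))
      rw [tsum_subtype {P | P ∈ F ∧ P ⊆ R} fun P => P.indicator (fun _ => (1 : ℝ≥0∞)) x]
      calc (m : ℝ≥0∞) ≤ hfin'.toFinset.card := by exact_mod_cast hcard
        _ = ∑ P ∈ hfin'.toFinset, 1 := by simp
        _ = ∑ P ∈ hfin'.toFinset, indicator {P | P ∈ F ∧ P ⊆ R}
              (fun P => P.indicator (fun _ => (1 : ℝ≥0∞)) x) P := by
            refine Finset.sum_congr rfl fun P hP => ?_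
            rw [Finite.mem_toFinset] at hP
            rw [indicator_of_mem (s := {P | P ∈ F ∧ P ⊆ R}) hP.1,
              indicator_of_mem (hP.2.subset hxQ)]
        _ ≤ _ := ENNReal.sum_le_tsum _
    have hmI : ∀ P : {P | P ∈ F ∧ P ⊆ R},
        Measurable ((P : Set (RSpace n)).indicator fun _ => (1 : ℝ≥0∞)) :=
      fun P => measurable_const.indicator (hmeas _ P.2.1)
    have hV : m * volume V ≤ ∑' P : {P | P ∈ F ∧ P ⊆ R}, volume (P : Set (RSpace n)) :=
      calc m * volume V
          ≤ m * volume {x | (m : ℝ≥0∞) ≤ ∑' P : {P | P ∈ F ∧ P ⊆ R},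
              (P : Set (RSpace n)).indicator (fun _ => (1 : ℝ≥0∞)) x} := by gcongr; exact hpt
        _ ≤ ∫⁻ x, ∑' P : {P | P ∈ F ∧ P ⊆ R},
              (P : Set (RSpace n)).indicator (fun _ => (1 : ℝ≥0∞)) x :=
            mul_meas_ge_le_lintegral (Measurable.tsum hmI) _
        _ = _ := by
            rw [lintegral_tsum fun P => (hmI P).aemeasurable]
            refine tsum_congr fun P => ?_
            rw [lintegral_indicator_const (hmeas _ P.2.1), one_mul]
    have h2 : (m : ℝ≥0∞) * (2 * volume V) ≤ m * volume R := by
      refine le_trans ?_ (hcarl R hR.1)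
      rw [mul_left_comm]; gcongr
    rw [ENNReal.mul_le_mul_iff_right (by simpa using hm.ne') (by simp)] at h2
    rw [ENNReal.le_div_iff_mul_le (by simp) (by simp), mul_comm]
    exact h2

/-- Sorting the members of `F` by their levels, and these by residue and quotient modulo `m`. -/
lemma tsum_le_sum_sparseOperator {m : ℕ} (hm : 0 < m) (g : RSpace n → ℝ≥0∞) (x : RSpace n) :
    ∑' R : F, (R : Set (RSpace n)).indicator
        (fun _ => ⨍⁻ y in (R : Set (RSpace n)), g y ∂volume) x ≤
      ∑ r : Fin m, sparseOperator (levelClass F m r) g x := by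
  let h : Set (RSpace n) → ℝ≥0∞ := fun R => R.indicator (fun _ => ⨍⁻ y in R, g y ∂volume) x
  have hF : F ⊆ ⋃ r : Fin m, ⋃ t : ℕ, levelClass F m r t := by
    intro R hR
    refine mem_iUnion.2 ⟨⟨level F R % m, Nat.mod_lt _ hm⟩, mem_iUnion.2 ⟨level F R / m, hR, ?_⟩⟩
    exact (Nat.mod_add_div' _ _).symm
  calc ∑' R : F, h R ≤ ∑' R : ⋃ r : Fin m, ⋃ t : ℕ, levelClass F m r t, h R :=
        ENNReal.tsum_mono_subtype h hF
    _ ≤ ∑ r : Fin m, ∑' R : ⋃ t : ℕ, levelClass F m r t, h R := ENNReal.tsum_iUnion_le h _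
    _ ≤ ∑ r : Fin m, ∑' t : ℕ, ∑' R : levelClass F m r t, h R := by
        gcongr with r
        exact ENNReal.tsum_iUnion_le_tsum h _

end Level

lemma measurable_sparseOperator {S : ℕ → Set (Set (RSpace n))} (hc : ∀ k, (S k).Countable)
    (hm : ∀ k, ∀ Q ∈ S k, MeasurableSet Q) (g : RSpace n → ℝ≥0∞) :
    Measurable (sparseOperator S g) := by
  refine Measurable.tsum fun k => ?_
  have : Countable (S k) := hc k
  exact Measurable.tsum fun Q => measurable_const.indicator (hm k _ Q.2)

/-! ### The Hardy–Littlewood maximal function -/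

/-- The volume of the unit ball. -/
noncomputable def unitVol (n : ℕ) : ℝ≥0∞ := volume (Metric.ball (0 : RSpace n) 1)

lemma unitVol_ne_top : unitVol n ≠ ∞ := Metric.isBounded_ball.measure_lt_top.ne

lemma unitVol_ne_zero : unitVol n ≠ 0 := (Metric.measure_ball_pos _ _ one_pos).ne'

lemma volume_ball_eq (x : RSpace n) {r : ℝ} (hr : 0 < r) :
    volume (Metric.ball x r) = ENNReal.ofReal r ^ n * unitVol n := by
  rw [Measure.addHaar_ball_of_pos _ _ hr, finrank_euclideanSpace_fin, ENNReal.ofReal_pow hr.le,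
    unitVol]

lemma volume_closedBall_eq (x : RSpace n) {r : ℝ} (hr : 0 < r) :
    volume (Metric.closedBall x r) = ENNReal.ofReal r ^ n * unitVol n := by
  rw [Measure.addHaar_closedBall _ _ hr.le, finrank_euclideanSpace_fin, ENNReal.ofReal_pow hr.le,
    unitVol]

/-- The uncentred Hardy–Littlewood maximal function over balls, with `r ^ n` in place of the volume
of a ball of radius `r`. -/
noncomputable def maximalFn (g : RSpace n → ℝ≥0∞) (x : RSpace n) : ℝ≥0∞ :=
  ⨆ (z : RSpace n) (r : ℝ) (_ : 0 < r) (_ : x ∈ Metric.ball z r),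
    (∫⁻ y in Metric.ball z r, g y) / ENNReal.ofReal r ^ n

lemma ofReal_pow_ne_zero {r : ℝ} (hr : 0 < r) : ENNReal.ofReal r ^ n ≠ 0 := by
  simp [hr]

lemma setLIntegral_ball_le (g : RSpace n → ℝ≥0∞) {x z : RSpace n} {r : ℝ} (hr : 0 < r)
    (hx : x ∈ Metric.ball z r) :
    ∫⁻ y in Metric.ball z r, g y ≤ ENNReal.ofReal r ^ n * maximalFn g x := by
  rw [mul_comm, ← ENNReal.div_le_iff (ofReal_pow_ne_zero hr) (by finiteness)]
  exact le_iSup_of_le z (le_iSup_of_le r (le_iSup_of_le hr (le_iSup_of_le hx le_rfl)))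

lemma lt_maximalFn_iff {g : RSpace n → ℝ≥0∞} {x : RSpace n} {a : ℝ≥0∞} :
    a < maximalFn g x ↔ ∃ z r, 0 < r ∧ x ∈ Metric.ball z r ∧
      a < (∫⁻ y in Metric.ball z r, g y) / ENNReal.ofReal r ^ n := by
  simp only [maximalFn, lt_iSup_iff, exists_prop]

lemma isOpen_lt_maximalFn (g : RSpace n → ℝ≥0∞) (a : ℝ≥0∞) :
    IsOpen {x | a < maximalFn g x} := by
  rw [isOpen_iff_forall_mem_open]
  intro x hx
  obtain ⟨z, r, hr, hxz, h⟩ := lt_maximalFn_iff.1 hx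
  exact ⟨Metric.ball z r, fun y hy => lt_maximalFn_iff.2 ⟨z, r, hr, hy, h⟩, Metric.isOpen_ball, hxz⟩

lemma maximalFn_mono {g h : RSpace n → ℝ≥0∞} (hgh : ∀ x, g x ≤ h x) (x : RSpace n) :
    maximalFn g x ≤ maximalFn h x := by
  unfold maximalFn
  gcongr with z r hr hx
  exact hgh _

lemma maximalFn_congr {g h : RSpace n → ℝ≥0∞} (hgh : g =ᵐ[volume] h) (x : RSpace n) :
    maximalFn g x = maximalFn h x := by
  unfold maximalFn
  simp only [lintegral_congr_ae (ae_restrict_of_ae hgh)]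

/-- The weak type `(1, 1)` estimate, by Vitali's covering theorem. -/
lemma exists_maximalFn_weak (hn : 1 ≤ n) : ∃ C : ℝ≥0, ∀ (g : RSpace n → ℝ≥0∞) (a : ℝ≥0∞),
    a * volume {x | a < maximalFn g x} ≤ C * ∫⁻ x, g x := by
  have hCtop : 4 ^ n * unitVol n ≠ ∞ := ENNReal.mul_ne_top (by finiteness) unitVol_ne_top
  have hC0 : 4 ^ n * unitVol n ≠ 0 := mul_ne_zero (by simp) unitVol_ne_zero
  refine ⟨(4 ^ n * unitVol n).toNNReal, fun g a => ?_⟩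
  rw [ENNReal.coe_toNNReal hCtop]
  rcases eq_or_ne a 0 with rfl | ha0
  · simp
  rcases eq_or_ne a ∞ with rfl | hat
  · simp
  rcases eq_or_ne (∫⁻ x, g x) ∞ with hg | hg
  · rw [hg, ENNReal.mul_top hC0]; exact le_top
  let t : Set (RSpace n × ℝ) :=
    {p | 0 < p.2 ∧ a * ENNReal.ofReal p.2 ^ n ≤ ∫⁻ y in Metric.ball p.1 p.2, g y}
  -- The radii are bounded because `a r ^ n` is at most the total integral.
  have hbound : ∀ p ∈ t, p.2 ≤ max 1 ((∫⁻ x, g x) / a).toReal := by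
    rintro ⟨z, r⟩ ⟨hr, h⟩
    rcases le_or_gt r 1 with h1 | h1
    · exact le_max_of_le_left h1
    refine le_max_of_le_right ?_
    rw [← ENNReal.ofReal_le_iff_le_toReal (ENNReal.div_ne_top hg ha0),
      ENNReal.le_div_iff_mul_le (.inl ha0) (.inl hat), mul_comm]
    refine le_trans ?_ (h.trans (setLIntegral_le_lintegral _ _))
    gcongr
    exact le_self_pow₀ (by simpa using h1.le) (by lia)
  obtain ⟨u, hut, hdisj, hcov⟩ := Vitali.exists_disjoint_subfamily_covering_enlargement_closedBall
    t Prod.fst Prod.snd _ hbound 4 (by norm_num)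
  have hdisj' : u.PairwiseDisjoint fun p => Metric.ball p.1 p.2 :=
    hdisj.mono fun p => Metric.ball_subset_closedBall
  have hu : u.Countable := hdisj'.countable_of_isOpen (fun p _ => Metric.isOpen_ball)
    fun p hp => Metric.nonempty_ball.2 (hut hp).1
  have : Countable u := hu
  have hsub : {x | a < maximalFn g x} ⊆ ⋃ p : u, Metric.closedBall p.1.1 (4 * p.1.2) := by
    intro x hx
    obtain ⟨z, r, hr, hxz, h⟩ := lt_maximalFn_iff.1 hx
    have hmem : (z, r) ∈ t := by
      refine ⟨hr, ?_⟩
      exact (ENNReal.le_div_iff_mul_le (.inl (ofReal_pow_ne_zero hr)) (.inl (by finiteness))).1 h.le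
    obtain ⟨b, hb, hsub⟩ := hcov _ hmem
    exact mem_iUnion.2 ⟨⟨b, hb⟩, hsub (Metric.ball_subset_closedBall hxz)⟩
  calc a * volume {x | a < maximalFn g x}
      ≤ a * ∑' p : u, volume (Metric.closedBall p.1.1 (4 * p.1.2)) := by
        gcongr; exact (measure_mono hsub).trans (measure_iUnion_le _)
    _ = ∑' p : u, 4 ^ n * unitVol n * (a * ENNReal.ofReal p.1.2 ^ n) := by
        rw [← ENNReal.tsum_mul_left]
        refine tsum_congr fun p => ?_
        have := (hut p.2).1
        rw [volume_closedBall_eq _ (by positivity), ENNReal.ofReal_mul (by norm_num), mul_pow,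
          ENNReal.ofReal_ofNat]
        ring
    _ ≤ ∑' p : u, 4 ^ n * unitVol n * ∫⁻ y in Metric.ball p.1.1 p.1.2, g y := by
        gcongr with p
        exact (hut p.2).2
    _ = 4 ^ n * unitVol n * ∫⁻ y in ⋃ p : u, Metric.ball p.1.1 p.1.2, g y := by
        rw [ENNReal.tsum_mul_left, lintegral_iUnion (fun p => measurableSet_ball)]
        exact fun p q hpq => hdisj' p.2 q.2 (Subtype.coe_injective.ne hpq)
    _ ≤ _ := by gcongr; exact Measure.restrict_le_self

/-- The maximal function controls convolution with `r ^ δ / |x| ^ (n + δ)` away from the origin: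
sum over dyadic annuli. -/
lemma exists_tail_le (n : ℕ) {δ : ℝ} (hδ : 0 < δ) :
    ∃ C : ℝ≥0, ∀ (g : RSpace n → ℝ≥0∞) (x : RSpace n) (r : ℝ), 0 < r →
      ∫⁻ y in {y | r ≤ ‖x - y‖}, ENNReal.ofReal (r ^ δ / ‖x - y‖ ^ ((n : ℝ) + δ)) * g y ≤
        C * maximalFn g x := by
  set q : ℝ := (1 / 2 : ℝ) ^ δ with hq
  have hq0 : 0 < q := by positivity
  have hq1 : q < 1 := Real.rpow_lt_one (by norm_num) (by norm_num) hδ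
  have hfin : 2 ^ n * (1 - ENNReal.ofReal q)⁻¹ ≠ ∞ := by
    refine ENNReal.mul_ne_top (by finiteness) (ENNReal.inv_ne_top.2 ?_)
    exact (tsub_pos_of_lt (by simpa using hq1)).ne'
  refine ⟨(2 ^ n * (1 - ENNReal.ofReal q)⁻¹).toNNReal, fun g x r hr => ?_⟩
  rw [ENNReal.coe_toNNReal hfin]
  let A : ℕ → Set (RSpace n) := fun k => {y | 2 ^ k * r ≤ ‖x - y‖ ∧ ‖x - y‖ < 2 ^ (k + 1) * r}
  have hA : ∀ k, MeasurableSet (A k) := fun k =>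
    (measurableSet_le (f := fun _ => 2 ^ k * r) (by fun_prop) (by fun_prop)).inter
      (measurableSet_lt (g := fun _ => 2 ^ (k + 1) * r) (by fun_prop) (by fun_prop))
  have hcov : {y | r ≤ ‖x - y‖} ⊆ ⋃ k, A k := by
    intro y hy
    have hy' : 1 ≤ ‖x - y‖ / r := (one_le_div hr).2 hy
    obtain ⟨k, hk1, hk2⟩ := exists_nat_pow_near hy' one_lt_two
    exact mem_iUnion.2 ⟨k, (le_div_iff₀ hr).1 hk1, (div_lt_iff₀ hr).1 hk2⟩
  have hk : ∀ k, ∫⁻ y in A k, ENNReal.ofReal (r ^ δ / ‖x - y‖ ^ ((n : ℝ) + δ)) * g y ≤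
      2 ^ n * ENNReal.ofReal q ^ k * maximalFn g x := by
    intro k
    have hR : 0 < 2 ^ k * r := by positivity
    calc ∫⁻ y in A k, ENNReal.ofReal (r ^ δ / ‖x - y‖ ^ ((n : ℝ) + δ)) * g y
        ≤ ∫⁻ y in A k, ENNReal.ofReal (q ^ k / (2 ^ k * r) ^ n) * g y := by
          refine setLIntegral_mono' (hA k) fun y hy => ?_
          refine mul_le_mul_left (ENNReal.ofReal_le_ofReal ?_) _
          calc r ^ δ / ‖x - y‖ ^ ((n : ℝ) + δ) ≤ r ^ δ / (2 ^ k * r) ^ ((n : ℝ) + δ) := by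
                gcongr; exact hy.1
            _ = q ^ k / (2 ^ k * r) ^ n := by
                rw [Real.rpow_add hR, Real.rpow_natCast, Real.mul_rpow (by positivity) hr.le, hq,
                  ← Real.rpow_natCast ((1 / 2 : ℝ) ^ δ), ← Real.rpow_mul (by norm_num),
                  mul_comm δ, Real.rpow_mul (by norm_num), Real.rpow_natCast,
                  one_div, inv_pow, Real.inv_rpow (by positivity)]
                have := Real.rpow_pos_of_pos hr δ
                have : 0 < ((2 : ℝ) ^ k) ^ δ := by positivity
                field_simp
      _ = ENNReal.ofReal (q ^ k / (2 ^ k * r) ^ n) * ∫⁻ y in A k, g y :=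
          lintegral_const_mul' _ _ ENNReal.ofReal_ne_top
      _ ≤ ENNReal.ofReal (q ^ k / (2 ^ k * r) ^ n) *
            (ENNReal.ofReal (2 ^ (k + 1) * r) ^ n * maximalFn g x) := by
          gcongr
          refine le_trans (lintegral_mono_set fun y hy => ?_)
            (setLIntegral_ball_le g (by positivity) (Metric.mem_ball_self (x := x) (by positivity)))
          rw [mem_ball_iff_norm']
          exact hy.2
      _ = 2 ^ n * ENNReal.ofReal q ^ k * maximalFn g x := by
          rw [← mul_assoc, ← ENNReal.ofReal_pow (by positivity),
            ← ENNReal.ofReal_mul (by positivity), ← ENNReal.ofReal_pow hq0.le,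
            ← ENNReal.ofReal_ofNat 2, ← ENNReal.ofReal_pow (by norm_num),
            ← ENNReal.ofReal_mul (by positivity)]
          congr 2
          rw [pow_succ, mul_right_comm, mul_pow (2 ^ k * r)]
          field_simp
  calc _ ≤ ∫⁻ y in ⋃ k, A k, ENNReal.ofReal (r ^ δ / ‖x - y‖ ^ ((n : ℝ) + δ)) * g y :=
        lintegral_mono_set hcov
    _ ≤ ∑' k, ∫⁻ y in A k, ENNReal.ofReal (r ^ δ / ‖x - y‖ ^ ((n : ℝ) + δ)) * g y :=
        lintegral_iUnion_le _ _
    _ ≤ ∑' k, 2 ^ n * ENNReal.ofReal q ^ k * maximalFn g x := ENNReal.tsum_le_tsum hk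
    _ = _ := by
        rw [ENNReal.tsum_mul_right, ENNReal.tsum_mul_left, ENNReal.tsum_geometric]

/-- Lebesgue differentiation bounds a function by its maximal function. -/
lemma exists_ae_le_maximalFn (n : ℕ) : ∃ C : ℝ≥0, ∀ g : RSpace n → ℝ≥0∞, AEMeasurable g volume →
    ∫⁻ x, g x ≠ ∞ → ∀ᵐ x ∂(volume : Measure (RSpace n)), g x ≤ C * maximalFn g x := by
  have hfin : 2 ^ n * (unitVol n)⁻¹ ≠ ∞ :=
    ENNReal.mul_ne_top (by finiteness) (ENNReal.inv_ne_top.2 unitVol_ne_zero)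
  refine ⟨(2 ^ n * (unitVol n)⁻¹).toNNReal, fun g hg hgfin => ?_⟩
  rw [ENNReal.coe_toNNReal hfin]
  filter_upwards [(Besicovitch.vitaliFamily (volume : Measure (RSpace n))).ae_tendsto_lintegral_div
    hg hgfin] with x hx
  refine le_of_tendsto (hx.comp (Besicovitch.tendsto_filterAt volume x)) ?_
  filter_upwards [self_mem_nhdsWithin] with r (hr : 0 < r)
  simp only [Function.comp]
  rw [volume_closedBall_eq x hr]
  calc (∫⁻ y in Metric.closedBall x r, g y) / (ENNReal.ofReal r ^ n * unitVol n)
      ≤ (ENNReal.ofReal (2 * r) ^ n * maximalFn g x) / (ENNReal.ofReal r ^ n * unitVol n) := by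
        gcongr
        refine le_trans (lintegral_mono_set (Metric.closedBall_subset_ball (by linarith)))
          (setLIntegral_ball_le g (by positivity) (Metric.mem_ball_self (x := x) (by positivity)))
    _ = 2 ^ n * (unitVol n)⁻¹ * maximalFn g x := by
        rw [ENNReal.ofReal_mul (by norm_num), mul_pow, ENNReal.ofReal_ofNat, div_eq_mul_inv,
          ENNReal.mul_inv (.inr unitVol_ne_top) (.inr unitVol_ne_zero)]
        have := ENNReal.mul_inv_cancel (ofReal_pow_ne_zero (n := n) hr) (by finiteness)
        calc _ = 2 ^ n * (unitVol n)⁻¹ * maximalFn g x *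
              (ENNReal.ofReal r ^ n * (ENNReal.ofReal r ^ n)⁻¹) := by ring
          _ = _ := by rw [this, mul_one]

lemma setLIntegral_sq_le {α : Type*} [MeasurableSpace α] {μ : Measure α} {g : α → ℝ≥0∞}
    (hg : AEMeasurable g μ) (s : Set α) :
    (∫⁻ x in s, g x ∂μ) ^ 2 ≤ μ s * ∫⁻ x in s, g x ^ 2 ∂μ := by
  have h := ENNReal.lintegral_mul_le_Lp_mul_Lq (μ.restrict s) Real.HolderConjugate.two_two
    hg.restrict (aemeasurable_const (b := (1 : ℝ≥0∞)))
  simp only [Pi.mul_apply, mul_one, lintegral_const, Measure.restrict_apply MeasurableSet.univ,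
    univ_inter, ENNReal.rpow_ofNat, one_pow, one_mul] at h
  have h2 := pow_le_pow_left' h 2
  rw [mul_pow, ← ENNReal.rpow_natCast, ← ENNReal.rpow_natCast, ← ENNReal.rpow_natCast,
    ← ENNReal.rpow_mul, ← ENNReal.rpow_mul] at h2
  norm_num at h2
  rwa [mul_comm]

/-- The Cauchy–Schwarz inequality on each ball. -/
lemma maximalFn_sq_le {g : RSpace n → ℝ≥0∞} (hg : AEMeasurable g volume) (x : RSpace n) :
    maximalFn g x ^ 2 ≤ unitVol n * maximalFn (fun y => g y ^ 2) x := by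
  suffices h : maximalFn g x ≤ (unitVol n * maximalFn (fun y => g y ^ 2) x) ^ (1 / 2 : ℝ) by
    have h2 := pow_le_pow_left' h 2
    rw [← ENNReal.rpow_natCast, ← ENNReal.rpow_natCast, ← ENNReal.rpow_mul] at h2
    norm_num at h2
    exact h2
  refine iSup_le fun z => iSup_le fun r => iSup_le fun hr => iSup_le fun hx => ?_
  have hr0 := ofReal_pow_ne_zero (n := n) hr
  have hrt : ENNReal.ofReal r ^ n ≠ ∞ := by finiteness
  rw [one_div, ENNReal.le_rpow_inv_iff (by norm_num), ENNReal.rpow_ofNat, div_eq_mul_inv, mul_pow,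
    ← ENNReal.inv_pow, ← div_eq_mul_inv, ENNReal.div_le_iff (pow_ne_zero _ hr0) (by finiteness)]
  calc (∫⁻ y in Metric.ball z r, g y) ^ 2
      ≤ volume (Metric.ball z r) * ∫⁻ y in Metric.ball z r, g y ^ 2 := setLIntegral_sq_le hg _
    _ ≤ ENNReal.ofReal r ^ n * unitVol n *
          (ENNReal.ofReal r ^ n * maximalFn (fun y => g y ^ 2) x) := by
        rw [volume_ball_eq z hr]
        gcongr
        exact setLIntegral_ball_le _ hr hx
    _ = _ := by ring

variable {𝕜 : Type*} [RCLike 𝕜]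

/-! ### Kernel estimates and truncated integrals -/

/-- The size and smoothness conditions on a kernel, with one constant `A` for all of them. -/
structure KernelBounds (K : RSpace n → RSpace n → 𝕜) (A δ : ℝ) : Prop where
  nonneg : 0 ≤ A
  pos : 0 < δ
  growth : ∀ x y, x ≠ y → ‖K x y‖ ≤ A / ‖x - y‖ ^ n
  smooth_left : ∀ x x' y, ‖x - x'‖ < ‖x - y‖ / 2 →
    ‖K x y - K x' y‖ ≤ A * ‖x - x'‖ ^ δ / ‖x - y‖ ^ ((n : ℝ) + δ)
  smooth_right : ∀ x x' y, ‖x - x'‖ < ‖x - y‖ / 2 →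
    ‖K y x - K y x'‖ ≤ A * ‖x - x'‖ ^ δ / ‖x - y‖ ^ ((n : ℝ) + δ)

lemma exists_kernelBounds {T : Lp 𝕜 2 (volume : Measure (RSpace n)) →L[𝕜]
    Lp 𝕜 2 (volume : Measure (RSpace n))} {K : RSpace n → RSpace n → 𝕜}
    (h : IsCalderonZygmund T K) : ∃ A δ, KernelBounds K A δ := by
  obtain ⟨a, ha⟩ := h.growth
  obtain ⟨b, δ, hδ, -, hb⟩ := h.smoothness
  have hb' : ∀ x x' y, ‖x - x'‖ < ‖x - y‖ / 2 → ‖K x y - K x' y‖ + ‖K y x - K y x'‖ ≤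
      max (max a b) 0 * ‖x - x'‖ ^ δ / ‖x - y‖ ^ ((n : ℝ) + δ) := by
    intro x x' y hx
    refine (hb x x' y hx).trans ?_
    gcongr
    exact (le_max_right a b).trans (le_max_left _ _)
  refine ⟨max (max a b) 0, δ, ⟨le_max_right _ _, hδ, fun x y hxy => (ha x y hxy).trans ?_,
    fun x x' y hx => ?_, fun x x' y hx => ?_⟩⟩
  · gcongr
    exact (le_max_left a b).trans (le_max_left _ _)
  · exact le_of_add_le_of_nonneg_left (hb' x x' y hx) (norm_nonneg _)
  · exact le_of_add_le_of_nonneg_right (hb' x x' y hx) (norm_nonneg _)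

/-- The open annulus centred at `x` with radii `ε` and `ν`. -/
def annulus (x : RSpace n) (ε ν : ℝ) : Set (RSpace n) := {y | ε < ‖x - y‖ ∧ ‖x - y‖ < ν}

lemma measurableSet_annulus (x : RSpace n) (ε ν : ℝ) : MeasurableSet (annulus x ε ν) :=
  (measurableSet_lt (f := fun _ => ε) (by fun_prop) (by fun_prop)).inter
    (measurableSet_lt (g := fun _ => ν) (by fun_prop) (by fun_prop))

/-- The half-closed annulus centred at `x` with radii `r` and `R`. -/
def shell (x : RSpace n) (r R : ℝ) : Set (RSpace n) := {y | r ≤ ‖x - y‖ ∧ ‖x - y‖ < R}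

lemma measurableSet_shell (x : RSpace n) (r R : ℝ) : MeasurableSet (shell x r R) :=
  (measurableSet_le (f := fun _ => r) (by fun_prop) (by fun_prop)).inter
    (measurableSet_lt (g := fun _ => R) (by fun_prop) (by fun_prop))

lemma measurableSet_far (x : RSpace n) (r : ℝ) : MeasurableSet {y | r < ‖x - y‖} :=
  measurableSet_lt (by fun_prop) (by fun_prop)

section Kernel

variable {K : RSpace n → RSpace n → 𝕜} {A δ : ℝ}

lemma KernelBounds.norm_le (hK : KernelBounds K A δ) {x y : RSpace n} {r : ℝ} (hr : 0 < r)
    (h : r ≤ ‖x - y‖) : ‖K x y‖ ≤ A / r ^ n := by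
  refine (hK.growth x y ?_).trans ?_
  · rintro rfl; simp at h; linarith
  · have := hK.nonneg
    gcongr

lemma continuousAt_of_norm_sub_le {E : Type*} [NormedAddCommGroup E] {F : RSpace n → E}
    {x y : RSpace n} (hxy : x ≠ y) {δ : ℝ} (hδ : 0 < δ) {C : ℝ}
    (h : ∀ x', ‖x - x'‖ < ‖x - y‖ / 2 → ‖F x - F x'‖ ≤ C * ‖x - x'‖ ^ δ / ‖x - y‖ ^ ((n : ℝ) + δ)) :
    ContinuousAt F x := by
  have hpos : 0 < ‖x - y‖ / 2 := by
    have := norm_pos_iff.2 (sub_ne_zero.2 hxy); positivity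
  rw [ContinuousAt, tendsto_iff_norm_sub_tendsto_zero]
  have hlim : Filter.Tendsto (fun x' => C * ‖x - x'‖ ^ δ / ‖x - y‖ ^ ((n : ℝ) + δ)) (nhds x)
      (nhds 0) := by
    have : ContinuousAt (fun x' => C * ‖x - x'‖ ^ δ / ‖x - y‖ ^ ((n : ℝ) + δ)) x := by
      refine ContinuousAt.div_const (continuousAt_const.mul ?_) _
      exact ContinuousAt.rpow_const (by fun_prop) (.inr hδ.le)
    simpa [ContinuousAt, Real.zero_rpow hδ.ne'] using this
  refine squeeze_zero' (Filter.Eventually.of_forall fun _ => norm_nonneg _) ?_ hlim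
  filter_upwards [Metric.ball_mem_nhds x hpos] with x' hx'
  rw [norm_sub_rev]
  exact h x' (by rwa [mem_ball_iff_norm'] at hx')

lemma KernelBounds.continuousAt_left (hK : KernelBounds K A δ) {x y : RSpace n} (h : x ≠ y) :
    ContinuousAt (fun x => K x y) x :=
  continuousAt_of_norm_sub_le h hK.pos fun x' hx' => hK.smooth_left x x' y hx'

lemma KernelBounds.continuousAt_right (hK : KernelBounds K A δ) {x y : RSpace n} (h : y ≠ x) :
    ContinuousAt (K x) y :=
  continuousAt_of_norm_sub_le h hK.pos fun y' hy' => hK.smooth_right y y' x hy'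

lemma KernelBounds.aestronglyMeasurable (hK : KernelBounds K A δ) (x : RSpace n)
    {S : Set (RSpace n)} (hS : MeasurableSet S) (hx : x ∉ S) :
    AEStronglyMeasurable (K x) (volume.restrict S) :=
  ContinuousOn.aestronglyMeasurable (fun _ hy => (hK.continuousAt_right
    (ne_of_mem_of_not_mem hy hx)).continuousWithinAt) hS

lemma KernelBounds.integrableOn (hK : KernelBounds K A δ) {f : RSpace n → 𝕜} {x : RSpace n}
    {S : Set (RSpace n)} (hS : MeasurableSet S) {r : ℝ} (hr : 0 < r) (hSr : ∀ y ∈ S, r ≤ ‖x - y‖)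
    (hf : IntegrableOn f S) : IntegrableOn (fun y => K x y * f y) S := by
  refine Integrable.bdd_mul (c := A / r ^ n) hf (hK.aestronglyMeasurable x hS fun hx => ?_) ?_
  · have := hSr x hx
    simp at this; linarith
  · exact (ae_restrict_iff' hS).2 (.of_forall fun y hy => hK.norm_le hr (hSr y hy))

lemma enorm_setIntegral_mul_le (K f : RSpace n → 𝕜) (S : Set (RSpace n)) :
    ‖∫ y in S, K y * f y‖ₑ ≤ ∫⁻ y in S, ‖K y‖ₑ * ‖f y‖ₑ := by
  simpa only [enorm_mul] using enorm_integral_le_lintegral_enorm (fun y => K y * f y)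

/-- The size condition on a single annulus. -/
lemma KernelBounds.lintegral_shell_le (hK : KernelBounds K A δ) (g : RSpace n → ℝ≥0∞)
    {x x₀ : RSpace n} {r R : ℝ} (hr : 0 < r) (hR : 0 < R) (hx₀ : x₀ ∈ Metric.ball x R) :
    ∫⁻ y in shell x r R, ‖K x y‖ₑ * g y ≤ ENNReal.ofReal (A * (R / r) ^ n) * maximalFn g x₀ := by
  have hA := hK.nonneg
  calc ∫⁻ y in shell x r R, ‖K x y‖ₑ * g y
      ≤ ∫⁻ y in shell x r R, ENNReal.ofReal (A / r ^ n) * g y := by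
        refine setLIntegral_mono' (measurableSet_shell x r R) fun y hy => ?_
        gcongr
        rw [← ofReal_norm]
        exact ENNReal.ofReal_le_ofReal (hK.norm_le hr hy.1)
    _ = ENNReal.ofReal (A / r ^ n) * ∫⁻ y in shell x r R, g y :=
        lintegral_const_mul' _ _ ENNReal.ofReal_ne_top
    _ ≤ ENNReal.ofReal (A / r ^ n) * (ENNReal.ofReal R ^ n * maximalFn g x₀) := by
        gcongr
        refine le_trans (lintegral_mono_set fun y hy => ?_) (setLIntegral_ball_le g hR hx₀)
        rw [mem_ball_iff_norm']
        exact hy.2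
    _ = _ := by
        rw [← mul_assoc, ← ENNReal.ofReal_pow hR.le, ← ENNReal.ofReal_mul (by positivity), div_pow]
        congr 2
        ring

/-- The smoothness condition away from the singularity. -/
lemma KernelBounds.exists_smooth_tail (hK : KernelBounds K A δ) : ∃ C : ℝ≥0,
    ∀ (g : RSpace n → ℝ≥0∞) (x x₀ : RSpace n) (d : ℝ), 0 < d → ‖x₀ - x‖ ≤ d →
      ∫⁻ y in {y | 2 * d < ‖x₀ - y‖}, ‖K x y - K x₀ y‖ₑ * g y ≤ C * maximalFn g x₀ := by
  obtain ⟨C, hC⟩ := exists_tail_le n hK.pos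
  refine ⟨A.toNNReal * C, fun g x x₀ d hd hx => ?_⟩
  have hA := hK.nonneg
  calc ∫⁻ y in {y | 2 * d < ‖x₀ - y‖}, ‖K x y - K x₀ y‖ₑ * g y
      ≤ ∫⁻ y in {y | 2 * d < ‖x₀ - y‖},
          ENNReal.ofReal A * (ENNReal.ofReal (d ^ δ / ‖x₀ - y‖ ^ ((n : ℝ) + δ)) * g y) := by
        refine setLIntegral_mono' (measurableSet_far _ _) fun y hy => ?_
        rw [← mul_assoc, ← ENNReal.ofReal_mul hA]
        gcongr
        rw [enorm_sub_rev, ← ofReal_norm]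
        refine ENNReal.ofReal_le_ofReal ?_
        have hy' : 2 * d < ‖x₀ - y‖ := hy
        refine (hK.smooth_left x₀ x y (by linarith)).trans ?_
        rw [mul_div_assoc]
        have := hK.pos
        gcongr
    _ = ENNReal.ofReal A * ∫⁻ y in {y | 2 * d < ‖x₀ - y‖},
          ENNReal.ofReal (d ^ δ / ‖x₀ - y‖ ^ ((n : ℝ) + δ)) * g y :=
        lintegral_const_mul' _ _ ENNReal.ofReal_ne_top
    _ ≤ ENNReal.ofReal A * (C * maximalFn g x₀) := by
        gcongr
        refine le_trans (lintegral_mono_set fun y hy => ?_) (hC g x₀ d hd)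
        have hy' : 2 * d < ‖x₀ - y‖ := hy
        show d ≤ ‖x₀ - y‖
        linarith
    _ = _ := by rw [← mul_assoc]; rfl

/-! ### The maximal truncated operator -/

lemma enorm_le_maximalTruncation (K : RSpace n → RSpace n → 𝕜) (f : RSpace n → 𝕜) (x : RSpace n)
    {ε ν : ℝ} (hε : 0 < ε) (hν : ε < ν) :
    ‖∫ y in annulus x ε ν, K x y * f y‖ₑ ≤ maximalTruncation K f x :=
  le_iSup_of_le ε (le_iSup_of_le ν (le_iSup_of_le hε (le_iSup_of_le hν le_rfl)))

lemma maximalTruncation_le {f : RSpace n → 𝕜} {x : RSpace n} {a : ℝ≥0∞}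
    (h : ∀ ε ν, 0 < ε → ε < ν → ‖∫ y in annulus x ε ν, K x y * f y‖ₑ ≤ a) :
    maximalTruncation K f x ≤ a :=
  iSup_le fun ε => iSup_le fun ν => iSup_le fun hε => iSup_le fun hν => h ε ν hε hν

lemma maximalTruncation_congr {f g : RSpace n → 𝕜} (h : f =ᵐ[volume] g) (x : RSpace n) :
    maximalTruncation K f x = maximalTruncation K g x := by
  unfold maximalTruncation
  refine iSup_congr fun ε => iSup_congr fun ν => iSup_congr fun _ => iSup_congr fun _ => ?_
  congr 1
  refine integral_congr_ae (ae_restrict_of_ae (μ := volume) ?_)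
  filter_upwards [h] with y hy
  rw [hy]

lemma integrableOn_annulus_of_locallyIntegrable {f : RSpace n → 𝕜}
    (hf : LocallyIntegrable f volume) (x : RSpace n) (ε ν : ℝ) :
    IntegrableOn f (annulus x ε ν) :=
  (hf.integrableOn_isCompact (isCompact_closedBall x ν)).mono_set fun y hy => by
    rw [mem_closedBall_iff_norm']; exact hy.2.le

lemma KernelBounds.integrableOn_annulus (hK : KernelBounds K A δ) {f : RSpace n → 𝕜}
    (hf : LocallyIntegrable f volume) (x : RSpace n) {ε : ℝ} (hε : 0 < ε) (ν : ℝ) :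
    IntegrableOn (fun y => K x y * f y) (annulus x ε ν) :=
  hK.integrableOn (measurableSet_annulus x ε ν) hε (fun _ hy => hy.1.le)
    (integrableOn_annulus_of_locallyIntegrable hf x ε ν)

lemma KernelBounds.maximalTruncation_add_le (hK : KernelBounds K A δ) {f g : RSpace n → 𝕜}
    (hf : LocallyIntegrable f volume) (hg : LocallyIntegrable g volume) (x : RSpace n) :
    maximalTruncation K (fun y => f y + g y) x ≤
      maximalTruncation K f x + maximalTruncation K g x := by
  refine maximalTruncation_le fun ε ν hε hν => ?_
  simp only [mul_add]
  rw [integral_add (hK.integrableOn_annulus hf x hε ν) (hK.integrableOn_annulus hg x hε ν)]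
  exact (enorm_add_le _ _).trans (add_le_add (enorm_le_maximalTruncation K f x hε hν)
    (enorm_le_maximalTruncation K g x hε hν))

/-- Truncated integrals depend continuously on the point, because spheres are null sets. -/
lemma KernelBounds.continuous_truncation (hK : KernelBounds K A δ) {f : RSpace n → 𝕜}
    (hf : LocallyIntegrable f volume) {ε ν : ℝ} (hε : 0 < ε) (hν : ε < ν) :
    Continuous fun x => ∫ y in annulus x ε ν, K x y * f y := by
  have hA := hK.nonneg
  simp only [← integral_indicator (measurableSet_annulus _ ε ν)]
  refine continuous_iff_continuousAt.2 fun x₀ => ?_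
  refine continuousAt_of_dominated
    (bound := (Metric.closedBall x₀ (ν + 1)).indicator fun y => A / ε ^ n * ‖f y‖) ?_ ?_ ?_ ?_
  · exact .of_forall fun x => ((hK.integrableOn_annulus hf x hε ν).integrable_indicator
      (measurableSet_annulus x ε ν)).aestronglyMeasurable
  · filter_upwards [Metric.ball_mem_nhds x₀ one_pos] with x hx
    refine .of_forall fun y => ?_
    by_cases hy : y ∈ annulus x ε ν
    · have hy' : y ∈ Metric.closedBall x₀ (ν + 1) := by
        rw [mem_closedBall_iff_norm']
        rw [mem_ball_iff_norm'] at hx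
        calc ‖x₀ - y‖ ≤ ‖x₀ - x‖ + ‖x - y‖ := norm_sub_le_norm_sub_add_norm_sub _ _ _
          _ ≤ ν + 1 := by linarith [hy.2]
      rw [indicator_of_mem hy, indicator_of_mem hy', norm_mul]
      gcongr
      exact hK.norm_le hε hy.1.le
    · rw [indicator_of_notMem hy, norm_zero]
      exact indicator_nonneg (fun y _ => by positivity) y
  · refine IntegrableOn.integrable_indicator ?_ measurableSet_closedBall
    exact ((hf.integrableOn_isCompact (isCompact_closedBall x₀ _)).norm).const_mul _
  · have h1 := Measure.addHaar_sphere_of_ne_zero (volume : Measure (RSpace n)) x₀ hε.ne'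
    have h2 := Measure.addHaar_sphere_of_ne_zero (volume : Measure (RSpace n)) x₀ (hε.trans hν).ne'
    filter_upwards [measure_eq_zero_iff_ae_notMem.1 h1, measure_eq_zero_iff_ae_notMem.1 h2]
      with y hy1 hy2
    rw [mem_sphere_iff_norm, norm_sub_rev] at hy1 hy2
    have hcont : ContinuousAt (fun x : RSpace n => ‖x - y‖) x₀ := by fun_prop
    by_cases hy : y ∈ annulus x₀ ε ν
    · have hev : ∀ᶠ x in nhds x₀, y ∈ annulus x ε ν :=
        (hcont.eventually (lt_mem_nhds hy.1)).and (hcont.eventually (gt_mem_nhds hy.2))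
      have hne : x₀ ≠ y := by
        rintro rfl
        have := hy.1
        simp at this; linarith
      refine ContinuousAt.congr ((hK.continuousAt_left hne).mul
        (continuousAt_const (y := f y))) ?_
      filter_upwards [hev] with x hx
      exact (indicator_of_mem (f := fun y => K x y * f y) hx).symm
    · have hev : ∀ᶠ x in nhds x₀, y ∉ annulus x ε ν := by
        rcases lt_or_gt_of_ne hy1 with h | h
        · filter_upwards [hcont.eventually (gt_mem_nhds h)] with x hx hx'
          exact hx.not_gt hx'.1
        · rcases lt_or_gt_of_ne hy2 with h' | h'
          · exact (hy ⟨h, h'⟩).elim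
          · filter_upwards [hcont.eventually (lt_mem_nhds h')] with x hx hx'
            exact hx.not_gt hx'.2
      refine ContinuousAt.congr (continuousAt_const (y := (0 : 𝕜))) ?_
      filter_upwards [hev] with x hx
      exact (indicator_of_notMem hx fun y => K x y * f y).symm

/-- `T_♮ f` is lower semicontinuous, being a supremum of continuous functions. -/
lemma KernelBounds.isOpen_lt_maximalTruncation (hK : KernelBounds K A δ) {f : RSpace n → 𝕜}
    (hf : LocallyIntegrable f volume) (a : ℝ≥0∞) : IsOpen {x | a < maximalTruncation K f x} := by
  have : {x | a < maximalTruncation K f x} = ⋃ (ε : ℝ) (ν : ℝ) (_ : 0 < ε) (_ : ε < ν),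
      {x | a < ‖∫ y in annulus x ε ν, K x y * f y‖ₑ} := by
    ext x
    simp only [maximalTruncation, annulus, mem_ofPred_eq, lt_iSup_iff, mem_iUnion]
  rw [this]
  refine isOpen_iUnion fun ε => isOpen_iUnion fun ν => isOpen_iUnion fun hε =>
    isOpen_iUnion fun hν => ?_
  exact isOpen_lt continuous_const (hK.continuous_truncation hf hε hν).enorm

/-! ### Comparison of truncations at nearby points -/

/-- When the centre moves by a small fraction of the radii, the annulus changes only near its
boundary spheres. -/
lemma annulus_diff_subset {x x₀ : RSpace n} {d ε ν : ℝ} (hx : ‖x₀ - x‖ ≤ d)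
    (hε : 4 * d ≤ ε) :
    annulus x ε ν \ annulus x₀ ε ν ⊆ shell x (ε / 2) (2 * ε) ∪ shell x (ν / 2) (2 * ν) := by
  rintro y ⟨⟨h1, h2⟩, hy⟩
  have e1 : ‖x₀ - y‖ ≤ ‖x₀ - x‖ + ‖x - y‖ := norm_sub_le_norm_sub_add_norm_sub _ _ _
  have e2 : ‖x - y‖ ≤ ‖x - x₀‖ + ‖x₀ - y‖ := norm_sub_le_norm_sub_add_norm_sub _ _ _
  rw [norm_sub_rev x x₀] at e2
  rcases le_or_gt ‖x₀ - y‖ ε with h | h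
  · exact .inl ⟨by linarith, by linarith⟩
  · have : ν ≤ ‖x₀ - y‖ := by
      by_contra! h'
      exact hy ⟨h, h'⟩
    exact .inr ⟨by linarith, by linarith⟩

lemma KernelBounds.enorm_setIntegral_diff_le (hK : KernelBounds K A δ) {f : RSpace n → 𝕜}
    {x x₀ z : RSpace n} {d ε ν : ℝ} (hx : ‖x₀ - x‖ ≤ d) (hz : ‖x - z‖ ≤ d)
    (hε : 4 * d ≤ ε) (hε0 : 0 < ε) (hν : ε < ν) :
    ‖∫ y in annulus x ε ν \ annulus x₀ ε ν, K x y * f y‖ₑ ≤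
      2 * ENNReal.ofReal (A * 4 ^ n) * maximalFn (fun y => ‖f y‖ₑ) z := by
  have key : ∀ t, ε ≤ t → ∫⁻ y in shell x (t / 2) (2 * t), ‖K x y‖ₑ * ‖f y‖ₑ ≤
      ENNReal.ofReal (A * 4 ^ n) * maximalFn (fun y => ‖f y‖ₑ) z := by
    intro t ht
    have ht0 : 0 < t := by linarith
    refine (hK.lintegral_shell_le (fun y => ‖f y‖ₑ) (x₀ := z) (half_pos ht0)
      (by linarith : 0 < 2 * t) ?_).trans_eq ?_
    · rw [mem_ball_iff_norm']; linarith
    · congr 4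
      field_simp; norm_num
  calc _ ≤ ∫⁻ y in annulus x ε ν \ annulus x₀ ε ν, ‖K x y‖ₑ * ‖f y‖ₑ :=
        enorm_setIntegral_mul_le _ _ _
    _ ≤ ∫⁻ y in shell x (ε / 2) (2 * ε) ∪ shell x (ν / 2) (2 * ν), ‖K x y‖ₑ * ‖f y‖ₑ :=
        lintegral_mono_set (annulus_diff_subset hx hε)
    _ ≤ _ := lintegral_union_le _ _ _
    _ ≤ _ := add_le_add (key ε le_rfl) (key ν hν.le)
    _ = _ := by ring

/-- Truncations at scales much larger than the distance of two points differ by at most the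
maximal function. -/
lemma KernelBounds.exists_truncation_le (hK : KernelBounds K A δ) : ∃ C : ℝ≥0,
    ∀ (f : RSpace n → 𝕜) (x x₀ : RSpace n) (d ε ν : ℝ), LocallyIntegrable f volume → 0 < d →
      ‖x₀ - x‖ ≤ d → 4 * d ≤ ε → ε < ν →
      ‖∫ y in annulus x ε ν, K x y * f y‖ₑ ≤ ‖∫ y in annulus x₀ ε ν, K x₀ y * f y‖ₑ +
        C * maximalFn (fun y => ‖f y‖ₑ) x₀ := by
  obtain ⟨C, hC⟩ := hK.exists_smooth_tail
  refine ⟨C + (4 * ENNReal.ofReal (A * 4 ^ n)).toNNReal, fun f x x₀ d ε ν hf hd hx hε hν => ?_⟩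
  have hε0 : 0 < ε := by linarith
  have hx' : ‖x - x₀‖ ≤ d := by rwa [norm_sub_rev]
  have hI := hK.integrableOn_annulus hf x hε0 ν
  have hI₀ := hK.integrableOn_annulus hf x₀ hε0 ν
  have e := integral_inter_add_sdiff (measurableSet_annulus x₀ ε ν) hI
  have e₀ := integral_inter_add_sdiff (measurableSet_annulus x ε ν) hI₀
  rw [inter_comm] at e₀
  have hsub : ∫ y in annulus x ε ν ∩ annulus x₀ ε ν, (K x y - K x₀ y) * f y =
      (∫ y in annulus x ε ν ∩ annulus x₀ ε ν, K x y * f y) -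
        ∫ y in annulus x ε ν ∩ annulus x₀ ε ν, K x₀ y * f y := by
    simp only [sub_mul]
    exact integral_sub (hI.mono_set inter_subset_left) (hI₀.mono_set inter_subset_right)
  have h1 : ‖∫ y in annulus x ε ν ∩ annulus x₀ ε ν, (K x y - K x₀ y) * f y‖ₑ ≤
      C * maximalFn (fun y => ‖f y‖ₑ) x₀ := by
    refine (enorm_setIntegral_mul_le (fun y => K x y - K x₀ y) f _).trans
      (le_trans (lintegral_mono_set fun y hy => ?_) (hC (fun y => ‖f y‖ₑ) x x₀ d hd hx))
    show 2 * d < ‖x₀ - y‖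
    linarith [hy.2.1]
  have h2 := hK.enorm_setIntegral_diff_le (f := f) (z := x₀) hx hx' hε hε0 hν
  have h3 := hK.enorm_setIntegral_diff_le (f := f) (z := x₀) (x := x₀) (x₀ := x) hx'
    (by simpa using hd.le) hε hε0 hν
  -- Split into the common part of the two annuli and the two parts near the boundary spheres.
  have e' : ∫ y in annulus x ε ν, K x y * f y =
      (∫ y in annulus x₀ ε ν, K x₀ y * f y) +
        (∫ y in annulus x ε ν ∩ annulus x₀ ε ν, (K x y - K x₀ y) * f y) +
        (∫ y in annulus x ε ν \ annulus x₀ ε ν, K x y * f y) -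
        ∫ y in annulus x₀ ε ν \ annulus x ε ν, K x₀ y * f y := by
    rw [hsub, ← e, ← e₀]; ring
  rw [e']
  refine enorm_sub_le.trans ((add_le_add_left ((enorm_add_le _ _).trans
    (add_le_add_left (enorm_add_le _ _) _)) _).trans ?_)
  refine (add_le_add (add_le_add (add_le_add_right h1 _) h2) h3).trans_eq ?_
  rw [ENNReal.coe_add, ENNReal.coe_toNNReal (by finiteness)]
  ring

/-- The influence on `T_♮` at `x` of the part of `g` at distance at least `l` is controlled by
`T_♮ g` and the maximal function at any point `x₀` at distance comparable to `l`. -/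
lemma KernelBounds.exists_maximalTruncation_far_le (hK : KernelBounds K A δ) {κ : ℝ} (hκ : 0 < κ) :
    ∃ C : ℝ≥0, ∀ (g : RSpace n → 𝕜) (S : Set (RSpace n)) (x x₀ : RSpace n) (l : ℝ),
      LocallyIntegrable g volume → MeasurableSet S → 0 < l → ‖x₀ - x‖ ≤ κ * l →
      (∀ y ∉ S, l ≤ ‖x - y‖) → (∀ y ∈ S, ‖x - y‖ ≤ κ * l) →
      maximalTruncation K (Sᶜ.indicator g) x ≤ maximalTruncation K g x₀ +
        C * maximalFn (fun y => ‖g y‖ₑ) x₀ := by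
  obtain ⟨C, hC⟩ := hK.exists_truncation_le
  refine ⟨C + (ENNReal.ofReal (A * (5 * κ) ^ n)).toNNReal, fun g S x x₀ l hg hS hl hx hfar hnear =>
    maximalTruncation_le fun ε ν hε hν => ?_⟩
  set d := κ * l with hd
  have hd0 : 0 < d := by positivity
  have hind : ∀ y, K x y * Sᶜ.indicator g y = Sᶜ.indicator (fun y => K x y * g y) y := by
    intro y
    by_cases hy : y ∈ Sᶜ <;> simp [hy]
  simp only [hind]
  rw [setIntegral_indicator hS.compl,
    ← integral_inter_add_sdiff (measurableSet_far x (4 * d))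
      ((hK.integrableOn_annulus hg x hε ν).mono_set inter_subset_left)]
  -- Farther than `4 d` the set `S` is not seen, and truncations at `x` and `x₀` are comparable;
  -- the remaining points lie in one annulus of bounded eccentricity.
  have h1 : ‖∫ y in (annulus x ε ν ∩ Sᶜ) ∩ {y | 4 * d < ‖x - y‖}, K x y * g y‖ₑ ≤
      maximalTruncation K g x₀ + C * maximalFn (fun y => ‖g y‖ₑ) x₀ := by
    have hset : (annulus x ε ν ∩ Sᶜ) ∩ {y | 4 * d < ‖x - y‖} = annulus x (max ε (4 * d)) ν := by
      ext y
      simp only [annulus, mem_inter_iff, mem_ofPred_eq, mem_compl_iff, max_lt_iff]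
      refine ⟨fun h => ⟨⟨h.1.1.1, h.2⟩, h.1.1.2⟩, fun h => ⟨⟨⟨h.1.1, h.2⟩, fun hyS => ?_⟩, h.1.2⟩⟩
      linarith [hnear y hyS, h.1.2]
    rw [hset]
    rcases lt_or_ge (max ε (4 * d)) ν with hlt | hge
    · refine (hC g x x₀ d _ ν hg hd0 hx (le_max_right _ _) hlt).trans ?_
      gcongr
      exact enorm_le_maximalTruncation K g x₀ (lt_max_of_lt_left hε) hlt
    · have : annulus x (max ε (4 * d)) ν = ∅ :=
        eq_empty_of_forall_notMem fun y hy => (hy.1.trans hy.2).not_ge hge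
      simp [this]
  have h2 : ‖∫ y in (annulus x ε ν ∩ Sᶜ) \ {y | 4 * d < ‖x - y‖}, K x y * g y‖ₑ ≤
      ENNReal.ofReal (A * (5 * κ) ^ n) * maximalFn (fun y => ‖g y‖ₑ) x₀ := by
    refine (enorm_setIntegral_mul_le _ _ _).trans (le_trans (lintegral_mono_set fun y hy => ?_)
      ((hK.lintegral_shell_le (fun y => ‖g y‖ₑ) (x := x) (x₀ := x₀) hl (R := 5 * d)
        (by positivity) ?_).trans_eq ?_))
    · have h4 : ‖x - y‖ ≤ 4 * d := not_lt.1 hy.2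
      exact ⟨hfar y hy.1.2, by linarith⟩
    · rw [mem_ball_iff_norm]; linarith
    · congr 4
      rw [hd]; field_simp
  refine (enorm_add_le _ _).trans ((add_le_add h1 h2).trans_eq ?_)
  rw [ENNReal.coe_add, ENNReal.coe_toNNReal (by finiteness)]
  ring

end Kernel

/-! ### The weak type `(2, 2)` estimate for the maximal truncated operator -/

lemma enorm_sq_eq_lintegral {α E : Type*} [MeasurableSpace α] {μ : Measure α}
    [NormedAddCommGroup E] (u : Lp E 2 μ) : ‖u‖ₑ ^ 2 = ∫⁻ x, ‖u x‖ₑ ^ 2 ∂μ := by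
  have h := eLpNorm_nnreal_pow_eq_lintegral (f := u) (μ := μ) (p := 2) two_ne_zero
  simpa [Lp.enorm_def] using h

lemma lintegral_enorm_sq_apply_le
    (T : Lp 𝕜 2 (volume : Measure (RSpace n)) →L[𝕜] Lp 𝕜 2 (volume : Measure (RSpace n)))
    {g : RSpace n → 𝕜} (hg : MemLp g 2 volume) :
    ∫⁻ z, ‖T (hg.toLp g) z‖ₑ ^ 2 ≤ ‖T‖ₑ ^ 2 * ∫⁻ y, ‖g y‖ₑ ^ 2 := by
  have h : ‖hg.toLp g‖ₑ ^ 2 = ∫⁻ y, ‖g y‖ₑ ^ 2 := by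
    rw [enorm_sq_eq_lintegral]
    refine lintegral_congr_ae ?_
    filter_upwards [hg.coeFn_toLp] with y hy
    rw [hy]
  rw [← enorm_sq_eq_lintegral, ← h, ← mul_pow]
  gcongr
  exact T.le_opENorm _

lemma add_add_sq_le (p q r : ℝ≥0∞) : (p + q + r) ^ 2 ≤ 9 * (p ^ 2 + q ^ 2 + r ^ 2) := by
  have h1 : p + q + r ≤ 3 * max (max p q) r :=
    calc p + q + r ≤ max (max p q) r + max (max p q) r + max (max p q) r := by
          gcongr
          · exact (le_max_left p q).trans (le_max_left _ _)
          · exact (le_max_right p q).trans (le_max_left _ _)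
          · exact le_max_right _ _
      _ = _ := by ring
  have h2 : max (max p q) r ^ 2 ≤ p ^ 2 + q ^ 2 + r ^ 2 := by
    rcases max_choice (max p q) r with h | h <;> rw [h]
    · rcases max_choice p q with h | h <;> rw [h]
      · rw [add_assoc]; exact le_self_add
      · exact (self_le_add_left _ _).trans le_self_add
    · exact self_le_add_left _ _
  calc (p + q + r) ^ 2 ≤ (3 * max (max p q) r) ^ 2 := by gcongr
    _ = 9 * max (max p q) r ^ 2 := by ring
    _ ≤ _ := by gcongr

section

variable {K : RSpace n → RSpace n → 𝕜} {A δ : ℝ}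
  {T : Lp 𝕜 2 (volume : Measure (RSpace n)) →L[𝕜] Lp 𝕜 2 (volume : Measure (RSpace n))}

/-- Cotlar's inequality in its pointwise form: near `x`, the truncated integral at `x` differs
from `T f - T (f - f₂)` by the maximal function, where `f₂ = f 1_S` is the far part of `f`. -/
lemma ae_enorm_truncation_le (hT : IsCalderonZygmund T K) (hK : KernelBounds K A δ) :
    ∃ C : ℝ≥0, ∀ (f : RSpace n → 𝕜) (_ : Integrable f) (h2 : MemLp f 2 volume)
      (x : RSpace n) (t : ℝ) (S : Set (RSpace n)) (_ : 0 < t) (hS : MeasurableSet S),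
      (∀ y ∈ S, t ≤ ‖x - y‖) →
      ∀ᵐ z ∂(volume : Measure (RSpace n)), z ∈ Metric.ball x (t / 4) →
        ‖∫ y in S, K x y * f y‖ₑ ≤ ‖T (h2.toLp f) z‖ₑ +
          ‖T ((h2.indicator hS.compl).toLp (Sᶜ.indicator f)) z‖ₑ +
          C * maximalFn (fun y => ‖f y‖ₑ) x := by
  obtain ⟨C, hC⟩ := hK.exists_smooth_tail
  refine ⟨C, fun f hf h2 x t S ht hS hfar => ?_⟩
  have hsum : h2.toLp f = (h2.indicator hS.compl).toLp (Sᶜ.indicator f) +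
      (h2.indicator hS).toLp (S.indicator f) := by
    rw [← MemLp.toLp_add]
    congr 1
    exact (indicator_compl_add_self S f).symm
  have hTsum := Lp.coeFn_add (T ((h2.indicator hS.compl).toLp (Sᶜ.indicator f)))
    (T ((h2.indicator hS).toLp (S.indicator f)))
  rw [← map_add, ← hsum] at hTsum
  have hsupp : tsupport (S.indicator f) ⊆ {y | t ≤ ‖x - y‖} := by
    refine closure_minimal (fun y hy => hfar y ?_)
      (isClosed_le (f := fun _ => t) (by fun_prop) (by fun_prop))
    by_contra h
    exact hy (indicator_of_notMem h f)
  filter_upwards [hTsum, hT.representation _ (h2.indicator hS)] with z hz hrep hzx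
  rw [mem_ball_iff_norm'] at hzx
  have hz' : z ∉ tsupport (S.indicator f) := fun h => by
    have : t ≤ ‖x - z‖ := hsupp h
    linarith
  have hfarz : ∀ y ∈ S, t / 2 ≤ ‖z - y‖ := by
    intro y hy
    have e1 : ‖x - y‖ ≤ ‖x - z‖ + ‖z - y‖ := norm_sub_le_norm_sub_add_norm_sub _ _ _
    linarith [hfar y hy]
  have hrep' : T ((h2.indicator hS).toLp (S.indicator f)) z = ∫ y in S, K z y * f y := by
    rw [hrep hz', ← integral_indicator hS]
    congr 1
    ext y
    by_cases hy : y ∈ S <;> simp [hy]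
  have hIx := hK.integrableOn hS ht hfar hf.integrableOn
  have hIz := hK.integrableOn hS (half_pos ht) hfarz hf.integrableOn
  have hdiff : ∫ y in S, K x y * f y = T (h2.toLp f) z -
      T ((h2.indicator hS.compl).toLp (Sᶜ.indicator f)) z -
        ∫ y in S, (K z y - K x y) * f y := by
    simp only [sub_mul]
    rw [integral_sub hIz hIx, hz, Pi.add_apply, hrep']
    ring
  rw [hdiff]
  refine enorm_sub_le.trans (add_le_add enorm_sub_le ?_)
  refine (enorm_setIntegral_mul_le (fun y => K z y - K x y) f _).trans
    (le_trans (lintegral_mono_set fun y hy => ?_)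
      (hC (fun y => ‖f y‖ₑ) z x (t / 4) (by positivity) hzx.le))
  show 2 * (t / 4) < ‖x - y‖
  linarith [hfar y hy]

/-- Averaging Cotlar's inequality in mean square over a ball around `x`. -/
lemma exists_enorm_truncation_sq_le (hT : IsCalderonZygmund T K) (hK : KernelBounds K A δ) :
    ∃ C : ℝ≥0, ∀ (f : RSpace n → 𝕜) (_ : Integrable f) (h2 : MemLp f 2 volume)
      (x : RSpace n) (t : ℝ) (S : Set (RSpace n)), 0 < t → MeasurableSet S →
      (∀ y ∈ S, t ≤ ‖x - y‖) → (∀ y ∉ S, ‖x - y‖ ≤ t) →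
      ‖∫ y in S, K x y * f y‖ₑ ^ 2 ≤
        C * maximalFn (fun y => ‖T (h2.toLp f) y‖ₑ ^ 2 + ‖f y‖ₑ ^ 2) x := by
  obtain ⟨C, hC⟩ := ae_enorm_truncation_le hT hK
  have hvinv : (unitVol n)⁻¹ ≠ ∞ := ENNReal.inv_ne_top.2 unitVol_ne_zero
  have hv := unitVol_ne_top (n := n)
  obtain ⟨D, hD⟩ : ∃ D : ℝ≥0, (D : ℝ≥0∞) = 9 * ((unitVol n)⁻¹ +
      ‖T‖ₑ ^ 2 * 8 ^ n * (unitVol n)⁻¹ + C ^ 2 * unitVol n) :=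
    ⟨_, ENNReal.coe_toNNReal <| ENNReal.mul_ne_top (by simp) <| ENNReal.add_ne_top.2
      ⟨ENNReal.add_ne_top.2 ⟨hvinv, ENNReal.mul_ne_top (ENNReal.mul_ne_top (by simp)
        (by simp)) hvinv⟩, ENNReal.mul_ne_top (by simp) hv⟩⟩
  refine ⟨D, fun f hf h2 x t S ht hS hfar hnear => ?_⟩
  let G : RSpace n → ℝ≥0∞ := fun y => ‖T (h2.toLp f) y‖ₑ ^ 2 + ‖f y‖ₑ ^ 2
  change _ ≤ D * maximalFn G x
  let u := T ((h2.indicator hS.compl).toLp (Sᶜ.indicator f))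
  set a := ‖∫ y in S, K x y * f y‖ₑ
  let B := Metric.ball x (t / 4)
  have ht4 : 0 < t / 4 := by positivity
  have hvolB : volume B = ENNReal.ofReal (t / 4) ^ n * unitVol n := volume_ball_eq x ht4
  have hTf : ∫⁻ z in B, ‖T (h2.toLp f) z‖ₑ ^ 2 ≤ ENNReal.ofReal (t / 4) ^ n * maximalFn G x := by
    refine le_trans (lintegral_mono fun z => ?_)
      (setLIntegral_ball_le G ht4 (Metric.mem_ball_self ht4))
    exact le_self_add
  have hTu : ∫⁻ z in B, ‖u z‖ₑ ^ 2 ≤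
      ‖T‖ₑ ^ 2 * (8 ^ n * ENNReal.ofReal (t / 4) ^ n * maximalFn G x) := by
    calc ∫⁻ z in B, ‖u z‖ₑ ^ 2 ≤ ∫⁻ z, ‖u z‖ₑ ^ 2 := setLIntegral_le_lintegral _ _
      _ ≤ ‖T‖ₑ ^ 2 * ∫⁻ y, ‖Sᶜ.indicator f y‖ₑ ^ 2 := lintegral_enorm_sq_apply_le T _
      _ = ‖T‖ₑ ^ 2 * ∫⁻ y in Sᶜ, ‖f y‖ₑ ^ 2 := by
          rw [← lintegral_indicator hS.compl]
          congr 2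
          ext y
          by_cases hy : y ∈ Sᶜ
          · simp only [indicator_of_mem hy]
          · simp only [indicator_of_notMem hy, enorm_zero, zero_pow two_ne_zero]
      _ ≤ ‖T‖ₑ ^ 2 * ∫⁻ y in Metric.ball x (8 * (t / 4)), G y := by
          refine mul_le_mul_right
            ((lintegral_mono_set fun y hy => ?_).trans (lintegral_mono fun y => ?_)) _
          · rw [mem_ball_iff_norm']
            linarith [hnear y hy]
          · exact self_le_add_left _ _
      _ ≤ ‖T‖ₑ ^ 2 * (ENNReal.ofReal (8 * (t / 4)) ^ n * maximalFn G x) := by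
          gcongr
          exact setLIntegral_ball_le G (by positivity) (Metric.mem_ball_self (by positivity))
      _ = _ := by
          rw [ENNReal.ofReal_mul (by norm_num), mul_pow, ENNReal.ofReal_ofNat]
  have hM : maximalFn (fun y => ‖f y‖ₑ) x ^ 2 ≤ unitVol n * maximalFn G x := by
    refine (maximalFn_sq_le h2.aestronglyMeasurable.enorm x).trans ?_
    gcongr
    exact maximalFn_mono (fun y => self_le_add_left _ _) x
  have hmT : AEMeasurable (fun z => ‖T (h2.toLp f) z‖ₑ ^ 2) (volume.restrict B) :=
    (Lp.aestronglyMeasurable _).enorm.restrict.pow_const 2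
  have hmu : AEMeasurable (fun z => ‖u z‖ₑ ^ 2) (volume.restrict B) :=
    (Lp.aestronglyMeasurable _).enorm.restrict.pow_const 2
  have hint : a ^ 2 * volume B ≤ 9 * ((∫⁻ z in B, ‖T (h2.toLp f) z‖ₑ ^ 2) +
      (∫⁻ z in B, ‖u z‖ₑ ^ 2) + (C * maximalFn (fun y => ‖f y‖ₑ) x) ^ 2 * volume B) := by
    rw [← setLIntegral_const, ← setLIntegral_const, ← lintegral_add_left' hmT,
      ← lintegral_add_right _ measurable_const, ← lintegral_const_mul' _ _ (by simp)]
    refine lintegral_mono_ae ((ae_restrict_iff' measurableSet_ball).2 ?_)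
    filter_upwards [hC f hf h2 x t S ht hS hfar] with z hz hzB
    exact (pow_le_pow_left' (hz hzB) 2).trans (add_add_sq_le _ _ _)
  have hpos : volume B ≠ 0 := (Metric.measure_ball_pos _ _ ht4).ne'
  have hfin : volume B ≠ ∞ := Metric.isBounded_ball.measure_lt_top.ne
  rw [← ENNReal.mul_le_mul_iff_left hpos hfin]
  refine hint.trans ?_
  have hcancel : (unitVol n)⁻¹ * unitVol n = 1 := ENNReal.inv_mul_cancel unitVol_ne_zero hv
  refine (mul_le_mul_right (add_le_add (add_le_add hTf hTu)
    (mul_le_mul_left (mul_pow (C : ℝ≥0∞) _ 2 ▸ mul_le_mul_right hM _) (volume B))) 9).trans_eq ?_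
  rw [hvolB, hD]
  generalize ENNReal.ofReal (t / 4) ^ n = R
  generalize maximalFn G x = M
  generalize ‖T‖ₑ = N
  generalize (C : ℝ≥0∞) = c
  generalize unitVol n = v at *
  calc _ = 9 * (R * M + N ^ 2 * (8 ^ n * R * M)) * 1 + 9 * (c ^ 2 * (v * M) * (R * v)) := by ring
    _ = _ := by rw [← hcancel]; ring

/-- An integral over an annulus is a difference of two integrals over complements of balls. -/
lemma KernelBounds.maximalTruncation_sq_le_of_far (hK : KernelBounds K A δ) {f : RSpace n → 𝕜}
    (hf : Integrable f) {x : RSpace n} {b : ℝ≥0∞}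
    (h : ∀ (t : ℝ) (S : Set (RSpace n)), 0 < t → MeasurableSet S →
      (∀ y ∈ S, t ≤ ‖x - y‖) → (∀ y ∉ S, ‖x - y‖ ≤ t) → ‖∫ y in S, K x y * f y‖ₑ ^ 2 ≤ b) :
    maximalTruncation K f x ^ 2 ≤ 4 * b := by
  suffices h' : maximalTruncation K f x ≤ 2 * b ^ (2⁻¹ : ℝ) by
    have h2 := pow_le_pow_left' h' 2
    rw [mul_pow, ← ENNReal.rpow_natCast (b ^ _), ← ENNReal.rpow_mul] at h2
    norm_num at h2
    exact h2
  have h1 : ∀ (t : ℝ) (S : Set (RSpace n)), 0 < t → MeasurableSet S →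
      (∀ y ∈ S, t ≤ ‖x - y‖) → (∀ y ∉ S, ‖x - y‖ ≤ t) →
      ‖∫ y in S, K x y * f y‖ₑ ≤ b ^ (2⁻¹ : ℝ) := by
    intro t S ht hS hfar hnear
    rw [ENNReal.le_rpow_inv_iff two_pos, ENNReal.rpow_ofNat]
    exact h t S ht hS hfar hnear
  refine maximalTruncation_le fun ε ν hε hν => ?_
  have hclosed : MeasurableSet {y | ν ≤ ‖x - y‖} := measurableSet_le (by fun_prop) (by fun_prop)
  have hI : IntegrableOn (fun y => K x y * f y) {y | ε < ‖x - y‖} :=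
    hK.integrableOn (measurableSet_far x ε) hε (fun y hy => le_of_lt hy) hf.integrableOn
  have e := integral_inter_add_sdiff hclosed hI
  have e1 : {y | ε < ‖x - y‖} ∩ {y | ν ≤ ‖x - y‖} = {y | ν ≤ ‖x - y‖} :=
    inter_eq_right.2 fun y hy => hν.trans_le hy
  have e2 : {y | ε < ‖x - y‖} \ {y | ν ≤ ‖x - y‖} = annulus x ε ν := by
    ext y; simp [annulus]
  rw [e1, e2, add_comm, ← eq_sub_iff_add_eq] at e
  rw [e, two_mul]
  refine enorm_sub_le.trans (add_le_add ?_ ?_)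
  · exact h1 ε _ hε (measurableSet_far x ε) (fun y hy => le_of_lt hy) fun y hy => not_lt.1 hy
  · exact h1 ν _ (hε.trans hν) hclosed (fun y hy => hy) fun y hy => (not_le.1 hy).le

/-- The weak type `(2, 2)` estimate, from the weak type `(1, 1)` estimate for the maximal function
of `|T f|² + |f|²`. -/
lemma exists_maximalTruncation_weak_two (hn : 1 ≤ n) (hT : IsCalderonZygmund T K)
    (hK : KernelBounds K A δ) :
    ∃ C : ℝ≥0, ∀ (f : RSpace n → 𝕜), Integrable f → MemLp f 2 volume → ∀ a : ℝ≥0∞,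
      a ^ 2 * volume {x | a < maximalTruncation K f x} ≤ C * ∫⁻ x, ‖f x‖ₑ ^ 2 := by
  obtain ⟨C₁, hC₁⟩ := exists_enorm_truncation_sq_le hT hK
  obtain ⟨C₂, hC₂⟩ := exists_maximalFn_weak hn
  -- The summand `1` keeps the divisor in the level of the maximal function nonzero.
  let C₃ : ℝ≥0 := 4 * C₁ + 1
  refine ⟨C₃ * (C₂ * (‖T‖₊ ^ 2 + 1)), fun f hf h2 a => ?_⟩
  let G : RSpace n → ℝ≥0∞ := fun y => ‖T (h2.toLp f) y‖ₑ ^ 2 + ‖f y‖ₑ ^ 2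
  have hC0 : (C₃ : ℝ≥0∞) ≠ 0 := by simp [C₃]
  have hsub : {x | a < maximalTruncation K f x} ⊆ {x | a ^ 2 / C₃ < maximalFn G x} := by
    intro x hx
    show a ^ 2 / C₃ < maximalFn G x
    rw [ENNReal.div_lt_iff (.inl hC0) (.inl ENNReal.coe_ne_top)]
    calc a ^ 2 < maximalTruncation K f x ^ 2 := by
          exact ENNReal.pow_right_strictMono two_ne_zero hx
      _ ≤ 4 * (C₁ * maximalFn G x) := hK.maximalTruncation_sq_le_of_far hf (hC₁ f hf h2 x)
      _ ≤ maximalFn G x * C₃ := by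
          rw [← mul_assoc, mul_comm]
          gcongr
          simp [C₃]
  have hGint : ∫⁻ x, G x ≤ (‖T‖₊ ^ 2 + 1 : ℝ≥0) * ∫⁻ x, ‖f x‖ₑ ^ 2 := by
    rw [lintegral_add_right' _ (h2.aestronglyMeasurable.enorm.pow_const 2), ENNReal.coe_add,
      add_mul, ENNReal.coe_one, one_mul, ENNReal.coe_pow]
    gcongr
    exact lintegral_enorm_sq_apply_le T h2
  calc a ^ 2 * volume {x | a < maximalTruncation K f x}
      ≤ a ^ 2 * volume {x | a ^ 2 / C₃ < maximalFn G x} := by gcongr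
    _ = C₃ * (a ^ 2 / C₃ * volume {x | a ^ 2 / C₃ < maximalFn G x}) := by
        rw [← mul_assoc, ENNReal.mul_div_cancel hC0 ENNReal.coe_ne_top]
    _ ≤ C₃ * (C₂ * ((‖T‖₊ ^ 2 + 1 : ℝ≥0) * ∫⁻ x, ‖f x‖ₑ ^ 2)) := by
        refine mul_le_mul_right ((hC₂ G _).trans ?_) _
        gcongr
    _ = _ := by push_cast; ring

end

/-! ### The Calderón–Zygmund decomposition -/

section GoodPart

open scoped Classical in
/-- The good part of `f` relative to a disjoint family of cubes: on each of the cubes, `f` is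
replaced by its average. -/
noncomputable def goodPart (f : RSpace n → 𝕜) (J : Set (DyadicIndex n)) (x : RSpace n) : 𝕜 :=
  if h : ∃ i ∈ J, x ∈ cube i then ⨍ y in cube h.choose, f y ∂volume else f x

variable {f : RSpace n → 𝕜} {J : Set (DyadicIndex n)}

lemma goodPart_of_mem (hJ : J.PairwiseDisjoint cube) {i : DyadicIndex n} (hi : i ∈ J)
    {x : RSpace n} (hx : x ∈ cube i) : goodPart f J x = ⨍ y in cube i, f y ∂volume := by
  have h : ∃ i ∈ J, x ∈ cube i := ⟨i, hi, hx⟩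
  have : h.choose = i := hJ.elim_set h.choose_spec.1 hi x h.choose_spec.2 hx
  rw [goodPart, dif_pos h, this]

lemma goodPart_of_notMem {x : RSpace n} (hx : x ∉ ⋃ i ∈ J, cube i) : goodPart f J x = f x := by
  rw [goodPart, dif_neg]
  simpa using hx

lemma measurableSet_biUnion_cube (J : Set (DyadicIndex n)) : MeasurableSet (⋃ i ∈ J, cube i) :=
  MeasurableSet.biUnion J.to_countable fun i _ => measurableSet_cube i

lemma aestronglyMeasurable_goodPart (hf : AEStronglyMeasurable f volume)
    (hJ : J.PairwiseDisjoint cube) : AEStronglyMeasurable (goodPart f J) volume := by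
  have h1 : AEStronglyMeasurable (goodPart f J) (volume.restrict (⋃ i : J, cube i.1)) := by
    refine aestronglyMeasurable_iUnion_iff.2 fun i => ?_
    refine (aestronglyMeasurable_const (b := ⨍ y in cube (i : DyadicIndex n), f y ∂volume)).congr ?_
    exact (ae_restrict_iff' (measurableSet_cube _)).2
      (.of_forall fun x hx => (goodPart_of_mem hJ i.2 hx).symm)
  have h2 : AEStronglyMeasurable (goodPart f J) (volume.restrict (⋃ i ∈ J, cube i)ᶜ) :=
    hf.restrict.congr ((ae_restrict_iff' (measurableSet_biUnion_cube J).compl).2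
      (.of_forall fun x hx => (goodPart_of_notMem hx).symm))
  rw [← biUnion_eq_iUnion J fun i _ => cube i] at h1
  have := aestronglyMeasurable_union_iff.2 ⟨h1, h2⟩
  rwa [union_compl_self, Measure.restrict_univ] at this

lemma volume_mul_enorm_average_le (f : RSpace n → 𝕜) (i : DyadicIndex n) :
    volume (cube i) * ‖⨍ y in cube i, f y ∂volume‖ₑ ≤ ∫⁻ y in cube i, ‖f y‖ₑ := by
  have h := measure_smul_setAverage f (volume_cube_ne_top i)
  calc volume (cube i) * ‖⨍ y in cube i, f y ∂volume‖ₑ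
      = ‖∫ y in cube i, f y‖ₑ := by
        rw [← h, enorm_smul, Measure.real, Real.enorm_of_nonneg ENNReal.toReal_nonneg,
          ENNReal.ofReal_toReal (volume_cube_ne_top i)]
    _ ≤ _ := enorm_integral_le_lintegral_enorm _

lemma lintegral_goodPart_le (hJ : J.PairwiseDisjoint cube) :
    ∫⁻ x, ‖goodPart f J x‖ₑ ≤ ∫⁻ x, ‖f x‖ₑ := by
  rw [← lintegral_add_compl _ (measurableSet_biUnion_cube J),
    ← lintegral_add_compl (fun x => ‖f x‖ₑ) (measurableSet_biUnion_cube J),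
    lintegral_biUnion J.to_countable (fun i _ => measurableSet_cube i) hJ,
    lintegral_biUnion J.to_countable (fun i _ => measurableSet_cube i) hJ]
  refine add_le_add (ENNReal.tsum_le_tsum fun i => ?_) ?_
  · rw [setLIntegral_congr_fun (g := fun _ => ‖⨍ y in cube i.1, f y ∂volume‖ₑ)
      (measurableSet_cube _) (fun x hx => congrArg _ (goodPart_of_mem hJ i.2 hx)),
      setLIntegral_const, mul_comm]
    exact volume_mul_enorm_average_le f i
  · refine setLIntegral_mono' (measurableSet_biUnion_cube J).compl fun x hx => ?_
    rw [goodPart_of_notMem hx]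

lemma integrable_goodPart (hf : Integrable f) (hJ : J.PairwiseDisjoint cube) :
    Integrable (goodPart f J) :=
  ⟨aestronglyMeasurable_goodPart hf.aestronglyMeasurable hJ,
    (lintegral_goodPart_le hJ).trans_lt hf.hasFiniteIntegral⟩

lemma setIntegral_sub_goodPart (hf : Integrable f) (hJ : J.PairwiseDisjoint cube)
    {i : DyadicIndex n} (hi : i ∈ J) : ∫ x in cube i, (f x - goodPart f J x) = 0 := by
  rw [integral_sub hf.integrableOn (integrable_goodPart hf hJ).integrableOn,
    setIntegral_congr_fun (g := fun _ => ⨍ y in cube i, f y ∂volume) (measurableSet_cube i)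
      (fun x hx => goodPart_of_mem hJ hi hx), setIntegral_const,
    measure_smul_setAverage f (volume_cube_ne_top i), sub_self]

lemma ae_enorm_goodPart_le (hJ : J.PairwiseDisjoint cube) {B : ℝ≥0∞}
    (hcube : ∀ i ∈ J, ∫⁻ y in cube i, ‖f y‖ₑ ≤ B * volume (cube i))
    (hout : ∀ᵐ x ∂(volume : Measure (RSpace n)), x ∉ ⋃ i ∈ J, cube i → ‖f x‖ₑ ≤ B) :
    ∀ᵐ x ∂(volume : Measure (RSpace n)), ‖goodPart f J x‖ₑ ≤ B := by
  filter_upwards [hout] with x hx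
  by_cases h : x ∈ ⋃ i ∈ J, cube i
  · obtain ⟨i, hi, hxi⟩ := mem_iUnion₂.1 h
    rw [goodPart_of_mem hJ hi hxi, ← ENNReal.mul_le_mul_iff_right (volume_cube_pos i)
      (volume_cube_ne_top i), mul_comm _ B]
    exact (volume_mul_enorm_average_le f i).trans (hcube i hi)
  · rw [goodPart_of_notMem h]
    exact hx h

end GoodPart

section BadPart

variable {K : RSpace n → RSpace n → 𝕜} {A δ : ℝ}

/-- The majorant of the contribution of the cubes in `J` to the truncations of a function `b` with
mean value zero on these cubes, away from them. -/
noncomputable def badMajorant (J : Set (DyadicIndex n)) (A δ : ℝ) (b : RSpace n → 𝕜)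
    (x : RSpace n) : ℝ≥0∞ :=
  ∑' i : J, ENNReal.ofReal (A * ((√n * side i.1.1) ^ δ / ‖corner i.1 - x‖ ^ ((n : ℝ) + δ))) *
    ∫⁻ y in cube i.1, ‖b y‖ₑ

/-- A cube that is small compared to its distance from `x` is contained in the annulus, or
disjoint from it, or contained in the shells around its boundary spheres. -/
lemma cube_subset_shell {x : RSpace n} {i : DyadicIndex n}
    (hx : 4 * (√n * side i.1) ≤ ‖x - corner i‖) {ε ν : ℝ}
    (h1 : ¬ cube i ⊆ annulus x ε ν) (h2 : (annulus x ε ν ∩ cube i).Nonempty) :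
    cube i ⊆ shell x (ε / 2) (2 * ε) ∪ shell x (ν / 2) (2 * ν) := by
  obtain ⟨u, hu, hua⟩ := not_subset.1 h1
  obtain ⟨v, hva, hv⟩ := h2
  have hdist : ∀ p ∈ cube i, ∀ q ∈ cube i, ‖x - p‖ ≤ ‖x - q‖ + √n * side i.1 := by
    intro p hp q hq
    have e : ‖x - p‖ ≤ ‖x - q‖ + ‖q - p‖ := norm_sub_le_norm_sub_add_norm_sub _ _ _
    linarith [norm_sub_le_of_mem_cube hq hp]
  have hvu := hdist v hv u hu
  have huv := hdist u hu v hv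
  have hs := side_pos i.1
  have hd : 0 ≤ √n * side i.1 := by positivity
  intro y hy
  have hc := hdist _ (corner_mem i) y hy
  have hyu := hdist y hy u hu
  have huy := hdist u hu y hy
  have hcv := hdist _ (corner_mem i) v hv
  have hcu := hdist _ (corner_mem i) u hu
  rcases le_or_gt ‖x - u‖ ε with h | h
  · refine .inl ⟨?_, ?_⟩ <;> linarith [hva.1]
  · have : ν ≤ ‖x - u‖ := by
      by_contra! h'
      exact hua ⟨h, h'⟩
    refine .inr ⟨?_, ?_⟩ <;> linarith [hva.2]

lemma KernelBounds.enorm_setIntegral_cube_le (hK : KernelBounds K A δ) (hn : 1 ≤ n)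
    {b : RSpace n → 𝕜} (hb : Integrable b) {x : RSpace n} {i : DyadicIndex n}
    (hbi : ∫ y in cube i, b y = 0)
    (hx : 4 * (√n * side i.1) ≤ ‖x - corner i‖) :
    ‖∫ y in cube i, K x y * b y‖ₑ ≤
      ENNReal.ofReal (A * ((√n * side i.1) ^ δ / ‖corner i - x‖ ^ ((n : ℝ) + δ))) *
        ∫⁻ y in cube i, ‖b y‖ₑ := by
  have hd : 0 < √n * side i.1 := by
    have := side_pos i.1
    have : (0 : ℝ) < n := by exact_mod_cast hn
    positivity
  have hfar : ∀ y ∈ cube i, √n * side i.1 ≤ ‖x - y‖ := by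
    intro y hy
    have e : ‖x - corner i‖ ≤ ‖x - y‖ + ‖y - corner i‖ := norm_sub_le_norm_sub_add_norm_sub _ _ _
    linarith [norm_sub_le_of_mem_cube hy (corner_mem i)]
  have hI := hK.integrableOn (measurableSet_cube i) hd hfar hb.integrableOn
  have hsub : ∫ y in cube i, K x y * b y = ∫ y in cube i, (K x y - K x (corner i)) * b y := by
    simp only [sub_mul]
    rw [integral_sub hI (hb.integrableOn.const_mul _), integral_const_mul, hbi]
    ring
  rw [hsub]
  refine (enorm_setIntegral_mul_le (fun y => K x y - K x (corner i)) b _).trans ?_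
  rw [← lintegral_const_mul' _ _ ENNReal.ofReal_ne_top]
  refine setLIntegral_mono' (measurableSet_cube i) fun y hy => ?_
  gcongr
  rw [enorm_sub_rev, ← ofReal_norm]
  refine ENNReal.ofReal_le_ofReal ?_
  have hyc := norm_sub_le_of_mem_cube (corner_mem i) hy
  rw [norm_sub_rev] at hx
  refine (hK.smooth_right (corner i) y x (by linarith)).trans ?_
  rw [mul_div_assoc]
  have := hK.nonneg
  have := hK.pos
  gcongr

/-- Off the dilated cubes, the bad part is controlled by cancellation on the cubes inside the
annulus, and by the maximal function for the cubes that meet its boundary. -/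
lemma KernelBounds.maximalTruncation_bad_le (hK : KernelBounds K A δ) (hn : 1 ≤ n)
    {b : RSpace n → 𝕜} (hb : Integrable b) {J : Set (DyadicIndex n)}
    (hJ : J.PairwiseDisjoint cube) (hbJ : ∀ y ∉ ⋃ i ∈ J, cube i, b y = 0)
    (hb0 : ∀ i ∈ J, ∫ y in cube i, b y = 0) {x : RSpace n}
    (hx : ∀ i ∈ J, 4 * (√n * side i.1) ≤ ‖x - corner i‖) :
    maximalTruncation K b x ≤ badMajorant J A δ b x +
      2 * ENNReal.ofReal (A * 4 ^ n) * maximalFn (fun y => ‖b y‖ₑ) x := by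
  refine maximalTruncation_le fun ε ν hε hν => ?_
  have hmeas : ∀ i : J, MeasurableSet (annulus x ε ν ∩ cube i.1) := fun i =>
    (measurableSet_annulus x ε ν).inter (measurableSet_cube _)
  have hdisj : Pairwise (Function.onFun Disjoint fun i : J => cube i.1) := fun i j hij =>
    hJ i.2 j.2 (Subtype.coe_injective.ne hij)
  have hdisj' : Pairwise (Function.onFun Disjoint fun i : J => annulus x ε ν ∩ cube i.1) :=
    fun i j hij => (hdisj hij).mono inter_subset_right inter_subset_right
  have hI := hK.integrableOn_annulus hb.locallyIntegrable x hε ν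
  have e1 : ∫ y in annulus x ε ν, K x y * b y =
      ∑' i : J, ∫ y in annulus x ε ν ∩ cube i.1, K x y * b y := by
    rw [← integral_iUnion hmeas hdisj'
      (hI.mono_set (iUnion_subset fun i => inter_subset_left))]
    refine setIntegral_eq_of_subset_of_forall_sdiff_eq_zero (measurableSet_annulus x ε ν)
      (iUnion_subset fun i => inter_subset_left) fun y hy => ?_
    rw [hbJ y ?_, mul_zero]
    intro h
    obtain ⟨i, hi, hyi⟩ := mem_iUnion₂.1 h
    exact hy.2 (mem_iUnion.2 ⟨⟨i, hi⟩, hy.1, hyi⟩)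
  set Sh := shell x (ε / 2) (2 * ε) ∪ shell x (ν / 2) (2 * ν) with hSh
  have hShm : MeasurableSet Sh := (measurableSet_shell _ _ _).union (measurableSet_shell _ _ _)
  have e2 : ∀ i : J, ‖∫ y in annulus x ε ν ∩ cube i.1, K x y * b y‖ₑ ≤
      ENNReal.ofReal (A * ((√n * side i.1.1) ^ δ / ‖corner i.1 - x‖ ^ ((n : ℝ) + δ))) *
        (∫⁻ y in cube i.1, ‖b y‖ₑ) + ∫⁻ y in Sh ∩ cube i.1, ‖K x y‖ₑ * ‖b y‖ₑ := by
    intro i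
    by_cases h1 : cube i.1 ⊆ annulus x ε ν
    · rw [inter_eq_right.2 h1]
      exact (hK.enorm_setIntegral_cube_le hn hb (hb0 i i.2) (hx i i.2)).trans le_self_add
    rcases (annulus x ε ν ∩ cube i.1).eq_empty_or_nonempty with h2 | h2
    · simp [h2]
    · refine (enorm_setIntegral_mul_le _ _ _).trans (le_trans (lintegral_mono_set ?_)
        le_add_self)
      exact subset_inter (inter_subset_right.trans (cube_subset_shell (hx i i.2) h1 h2))
        inter_subset_right
  have key : ∀ t, 0 < t → ∫⁻ y in shell x (t / 2) (2 * t), ‖K x y‖ₑ * ‖b y‖ₑ ≤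
      ENNReal.ofReal (A * 4 ^ n) * maximalFn (fun y => ‖b y‖ₑ) x := by
    intro t ht
    refine (hK.lintegral_shell_le (fun y => ‖b y‖ₑ) (x₀ := x) (half_pos ht)
      (by linarith : 0 < 2 * t) (Metric.mem_ball_self (by linarith))).trans_eq ?_
    congr 4
    field_simp; norm_num
  have e3 : ∑' i : J, ∫⁻ y in Sh ∩ cube i.1, ‖K x y‖ₑ * ‖b y‖ₑ ≤
      2 * ENNReal.ofReal (A * 4 ^ n) * maximalFn (fun y => ‖b y‖ₑ) x := by
    rw [← lintegral_iUnion (fun i : J => hShm.inter (measurableSet_cube i.1))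
      fun i j hij => (hdisj hij).mono inter_subset_right inter_subset_right]
    calc _ ≤ ∫⁻ y in Sh, ‖K x y‖ₑ * ‖b y‖ₑ :=
          lintegral_mono_set (iUnion_subset fun i => inter_subset_left)
      _ ≤ _ := lintegral_union_le _ _ _
      _ ≤ _ := add_le_add (key ε hε) (key ν (hε.trans hν))
      _ = _ := by ring
  rw [e1]
  refine enorm_tsum_le_tsum_enorm.trans ((ENNReal.tsum_le_tsum e2).trans ?_)
  rw [ENNReal.tsum_add]
  exact add_le_add le_rfl e3

lemma maximalFn_one_le (x : RSpace n) : maximalFn (fun _ => 1) x ≤ unitVol n := by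
  refine iSup_le fun z => iSup_le fun r => iSup_le fun hr => iSup_le fun _ => ?_
  rw [setLIntegral_const, one_mul, volume_ball_eq z hr,
    ENNReal.div_le_iff (ofReal_pow_ne_zero hr) (by finiteness), mul_comm]

lemma measurable_badMajorant (J : Set (DyadicIndex n)) (A δ : ℝ) (b : RSpace n → 𝕜) :
    Measurable (badMajorant J A δ b) := by
  refine Measurable.tsum fun i => Measurable.mul_const ?_ _
  refine ENNReal.measurable_ofReal.comp (measurable_const.mul (measurable_const.div ?_))
  exact (by fun_prop : Measurable fun x : RSpace n => ‖corner i.1 - x‖).pow_const _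

lemma exists_lintegral_badMajorant_le (hn : 1 ≤ n) (hA : 0 ≤ A) (hδ : 0 < δ) : ∃ C : ℝ≥0,
    ∀ (b : RSpace n → 𝕜) (J : Set (DyadicIndex n)) (E : Set (RSpace n)),
      J.PairwiseDisjoint cube → (∀ i ∈ J, ∀ x ∈ E, 4 * (√n * side i.1) ≤ ‖x - corner i‖) →
      ∫⁻ x in E, badMajorant J A δ b x ≤ C * ∫⁻ y, ‖b y‖ₑ := by
  obtain ⟨C, hC⟩ := exists_tail_le n hδ
  refine ⟨A.toNNReal * (C * (unitVol n).toNNReal), fun b J E hJ hE => ?_⟩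
  have hi : ∀ i : J, ∫⁻ x in E, ENNReal.ofReal
      (A * ((√n * side i.1.1) ^ δ / ‖corner i.1 - x‖ ^ ((n : ℝ) + δ))) *
        ∫⁻ y in cube i.1, ‖b y‖ₑ ≤
      ENNReal.ofReal A * (C * unitVol n) * ∫⁻ y in cube i.1, ‖b y‖ₑ := by
    intro i
    have hd : 0 < √n * side i.1.1 := by
      have := side_pos i.1.1
      have : (0 : ℝ) < n := by exact_mod_cast hn
      positivity
    rw [lintegral_mul_const]
    · gcongr
      simp only [ENNReal.ofReal_mul hA]
      rw [lintegral_const_mul' _ _ ENNReal.ofReal_ne_top]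
      gcongr
      calc _ ≤ ∫⁻ x in {x | √n * side i.1.1 ≤ ‖corner i.1 - x‖}, ENNReal.ofReal
            ((√n * side i.1.1) ^ δ / ‖corner i.1 - x‖ ^ ((n : ℝ) + δ)) * 1 := by
            simp only [mul_one]
            refine lintegral_mono_set fun x hx => ?_
            show _ ≤ ‖corner i.1 - x‖
            rw [norm_sub_rev]
            linarith [hE i i.2 x hx]
        _ ≤ C * maximalFn (fun _ => 1) (corner i.1) := hC (fun _ => 1) _ _ hd
        _ ≤ _ := by gcongr; exact maximalFn_one_le _
    · refine ENNReal.measurable_ofReal.comp (measurable_const.mul (measurable_const.div ?_))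
      exact (by fun_prop : Measurable fun x : RSpace n => ‖corner i.1 - x‖).pow_const _
  unfold badMajorant
  rw [lintegral_tsum fun i => ?_]
  · refine (ENNReal.tsum_le_tsum hi).trans ?_
    rw [ENNReal.tsum_mul_left,
      ← lintegral_biUnion J.to_countable (fun i _ => measurableSet_cube i) hJ]
    push_cast
    rw [ENNReal.coe_toNNReal unitVol_ne_top]
    gcongr
    · rfl
    · exact Measure.restrict_le_self
  · refine (Measurable.mul_const ?_ _).aemeasurable
    refine ENNReal.measurable_ofReal.comp (measurable_const.mul (measurable_const.div ?_))
    exact (by fun_prop : Measurable fun x : RSpace n => ‖corner i.1 - x‖).pow_const _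

end BadPart

/-! ### The weak type `(1, 1)` estimate for the maximal truncated operator -/

lemma pairwiseDisjoint_maximalCubes (U : Set (RSpace n)) :
    (maximalCubes U).PairwiseDisjoint cube := by
  intro i hi j hj hij
  rw [Function.onFun, disjoint_left]
  exact fun x hxi hxj => hij (eq_of_mem_maximalCubes hi hj hxi hxj)

lemma norm_sub_le_of_mem_parent {i : DyadicIndex n} {x y : RSpace n} (hx : x ∈ cube (parent i))
    (hy : y ∈ cube i) : ‖x - y‖ ≤ 2 * √n * side i.1 := by
  have := norm_sub_le_of_mem_cube hx (cube_subset_parent i hy)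
  rw [show (parent i).1 = i.1 + 1 from rfl, side_succ] at this
  linarith

/-- The averages over the Calderón–Zygmund cubes are bounded by the level, because the parent of
such a cube contains a point where the maximal function is at most `a`. -/
lemma setLIntegral_maximalCube_le {g : RSpace n → ℝ≥0∞} {a : ℝ≥0∞} {i : DyadicIndex n}
    (hi : i ∈ maximalCubes {x | a < maximalFn g x}) :
    ∫⁻ y in cube i, g y ≤ ENNReal.ofReal (2 * √n + 1) ^ n * a * volume (cube i) := by
  obtain ⟨x₀, hx₀, hx₀a⟩ := not_subset.1 hi.2
  have hs := side_pos i.1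
  have hr : 0 < (2 * √n + 1) * side i.1 := by positivity
  calc ∫⁻ y in cube i, g y ≤ ∫⁻ y in Metric.ball x₀ ((2 * √n + 1) * side i.1), g y := by
        refine lintegral_mono_set fun y hy => ?_
        rw [mem_ball_iff_norm']
        linarith [norm_sub_le_of_mem_parent hx₀ hy]
    _ ≤ ENNReal.ofReal ((2 * √n + 1) * side i.1) ^ n * maximalFn g x₀ :=
        setLIntegral_ball_le g hr (Metric.mem_ball_self hr)
    _ ≤ ENNReal.ofReal ((2 * √n + 1) * side i.1) ^ n * a := by
        gcongr; exact not_lt.1 hx₀a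
    _ = _ := by rw [ENNReal.ofReal_mul (by positivity), mul_pow, volume_cube]; ring

lemma volume_biUnion_ball_le (hn : 1 ≤ n) {J : Set (DyadicIndex n)}
    (hJ : J.PairwiseDisjoint cube) :
    volume (⋃ i ∈ J, Metric.ball (corner i) (4 * (√n * side i.1))) ≤
      ENNReal.ofReal (4 * √n) ^ n * unitVol n * volume (⋃ i ∈ J, cube i) := by
  rw [measure_biUnion J.to_countable hJ fun i _ => measurableSet_cube i, ← ENNReal.tsum_mul_left]
  refine (measure_biUnion_le _ J.to_countable _).trans (ENNReal.tsum_le_tsum fun i => le_of_eq ?_)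
  have hs := side_pos i.1.1
  have : (0 : ℝ) < n := by exact_mod_cast hn
  rw [volume_ball_eq _ (by positivity), ← mul_assoc, ENNReal.ofReal_mul (by positivity), mul_pow,
    volume_cube]
  ring

lemma memLp_two_of_ae_bound {g : RSpace n → 𝕜} (hg : Integrable g) {B : ℝ≥0∞} (hB : B ≠ ∞)
    (h : ∀ᵐ x ∂(volume : Measure (RSpace n)), ‖g x‖ₑ ≤ B) :
    ∫⁻ x, ‖g x‖ₑ ^ 2 ≤ B * ∫⁻ x, ‖g x‖ₑ ∧ MemLp g 2 volume := by
  have h1 : ∫⁻ x, ‖g x‖ₑ ^ 2 ≤ B * ∫⁻ x, ‖g x‖ₑ := by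
    rw [← lintegral_const_mul' _ _ hB]
    refine lintegral_mono_ae ?_
    filter_upwards [h] with x hx
    rw [sq]; gcongr
  refine ⟨h1, hg.aestronglyMeasurable, ?_⟩
  rw [eLpNorm_lt_top_iff_lintegral_rpow_enorm_lt_top two_ne_zero (by simp)]
  simp only [ENNReal.toReal_ofNat, ENNReal.rpow_ofNat]
  exact h1.trans_lt (ENNReal.mul_lt_top hB.lt_top hg.hasFiniteIntegral)

section WeakType

variable {K : RSpace n → RSpace n → 𝕜} {A δ : ℝ}
  {T : Lp 𝕜 2 (volume : Measure (RSpace n)) →L[𝕜] Lp 𝕜 2 (volume : Measure (RSpace n))}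

/-- The bad part of the weak type estimate, off the dilated cubes. -/
lemma exists_volume_bad_le (hn : 1 ≤ n) (hK : KernelBounds K A δ) : ∃ C : ℝ≥0,
    ∀ (b : RSpace n → 𝕜) (J : Set (DyadicIndex n)) (a : ℝ≥0∞), Integrable b →
      J.PairwiseDisjoint cube → (∀ y ∉ ⋃ i ∈ J, cube i, b y = 0) →
      (∀ i ∈ J, ∫ y in cube i, b y = 0) →
      a * volume ({x | 2 * a < maximalTruncation K b x} \
        ⋃ i ∈ J, Metric.ball (corner i) (4 * (√n * side i.1))) ≤ C * ∫⁻ y, ‖b y‖ₑ := by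
  obtain ⟨C₁, hC₁⟩ := exists_lintegral_badMajorant_le (𝕜 := 𝕜) hn hK.nonneg hK.pos
  obtain ⟨C₂, hC₂⟩ := exists_maximalFn_weak hn
  let D : ℝ≥0 := 2 * (A * 4 ^ n).toNNReal + 1
  have hD0 : (D : ℝ≥0∞) ≠ 0 := by simp [D]
  refine ⟨C₁ + D * C₂, fun b J a hb hJ hbJ hb0 => ?_⟩
  set W := ⋃ i ∈ J, Metric.ball (corner i) (4 * (√n * side i.1)) with hW
  have hWm : MeasurableSet W := MeasurableSet.biUnion J.to_countable fun _ _ => measurableSet_ball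
  have hWfar : ∀ i ∈ J, ∀ x ∈ Wᶜ, 4 * (√n * side i.1) ≤ ‖x - corner i‖ := by
    intro i hi x hx
    by_contra! h
    exact hx (mem_biUnion hi (mem_ball_iff_norm.2 h))
  have hsub : {x | 2 * a < maximalTruncation K b x} \ W ⊆
      ({x | a ≤ badMajorant J A δ b x} ∩ Wᶜ) ∪ {x | a / D < maximalFn (fun y => ‖b y‖ₑ) x} := by
    rintro x ⟨hx, hxW⟩
    have hx' : 2 * a < maximalTruncation K b x := hx
    by_contra hcon
    rw [mem_union, not_or] at hcon
    have h1 : badMajorant J A δ b x ≤ a := (not_le.1 fun h => hcon.1 ⟨h, hxW⟩).le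
    have h2 : maximalFn (fun y => ‖b y‖ₑ) x ≤ a / D := not_lt.1 hcon.2
    have h3 : D * maximalFn (fun y => ‖b y‖ₑ) x ≤ a :=
      (mul_le_mul_right h2 _).trans ENNReal.mul_div_le
    have h4 := hK.maximalTruncation_bad_le hn hb hJ hbJ hb0 fun i hi => hWfar i hi x hxW
    have h5 : 2 * ENNReal.ofReal (A * 4 ^ n) ≤ D := by
      simp only [D, ENNReal.coe_add, ENNReal.coe_mul]
      exact le_self_add
    refine hx'.not_ge (h4.trans ?_)
    rw [two_mul a]
    exact add_le_add h1 ((mul_le_mul_left h5 _).trans h3)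
  have hb1 : a * volume ({x | a ≤ badMajorant J A δ b x} ∩ Wᶜ) ≤ C₁ * ∫⁻ y, ‖b y‖ₑ := by
    rw [← Measure.restrict_apply (measurableSet_le measurable_const (measurable_badMajorant ..))]
    exact (mul_meas_ge_le_lintegral (measurable_badMajorant ..) a).trans (hC₁ b J _ hJ hWfar)
  have hb2 : a * volume {x | a / D < maximalFn (fun y => ‖b y‖ₑ) x} ≤
      D * (C₂ * ∫⁻ y, ‖b y‖ₑ) := by
    calc _ = D * (a / D * volume {x | a / D < maximalFn (fun y => ‖b y‖ₑ) x}) := by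
          rw [← mul_assoc, ENNReal.mul_div_cancel hD0 ENNReal.coe_ne_top]
      _ ≤ _ := mul_le_mul_right (hC₂ _ _) _
  calc _ ≤ a * (volume ({x | a ≤ badMajorant J A δ b x} ∩ Wᶜ) +
        volume {x | a / D < maximalFn (fun y => ‖b y‖ₑ) x}) := by
        gcongr; exact (measure_mono hsub).trans (measure_union_le _ _)
    _ ≤ C₁ * (∫⁻ y, ‖b y‖ₑ) + D * (C₂ * ∫⁻ y, ‖b y‖ₑ) := by
        rw [mul_add]; exact add_le_add hb1 hb2
    _ = _ := by push_cast; ring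

/-- The weak type `(1, 1)` estimate. The good part is bounded by a multiple of the level, so the
weak type `(2, 2)` estimate applies to it. -/
lemma exists_maximalTruncation_weak_one (hn : 1 ≤ n) (hT : IsCalderonZygmund T K)
    (hK : KernelBounds K A δ) : ∃ C : ℝ≥0, ∀ f : RSpace n → 𝕜, Integrable f → ∀ a : ℝ≥0∞,
      a * volume {x | a < maximalTruncation K f x} ≤ C * ∫⁻ x, ‖f x‖ₑ := by
  obtain ⟨C₁, hC₁⟩ := exists_maximalTruncation_weak_two hn hT hK
  obtain ⟨C₂, hC₂⟩ := exists_volume_bad_le hn hK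
  obtain ⟨C₃, hC₃⟩ := exists_maximalFn_weak hn
  obtain ⟨C₄, hC₄⟩ := exists_ae_le_maximalFn n
  let D : ℝ≥0 := (2 * √n + 1).toNNReal ^ n + C₄
  let V : ℝ≥0 := (4 * √n).toNNReal ^ n * (unitVol n).toNNReal
  -- It is enough to consider a level of the form `3 a`.
  suffices h : ∀ f : RSpace n → 𝕜, Integrable f → ∀ a : ℝ≥0∞, a ≠ 0 → a ≠ ∞ →
      a * volume {x | 3 * a < maximalTruncation K f x} ≤
        (C₁ * D + V * C₃ + 2 * C₂ : ℝ≥0) * ∫⁻ x, ‖f x‖ₑ by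
    refine ⟨3 * (C₁ * D + V * C₃ + 2 * C₂), fun f hf a => ?_⟩
    rcases eq_or_ne a 0 with rfl | ha0
    · simp
    rcases eq_or_ne a ∞ with rfl | hat
    · simp
    have h3 : 3 * (a / 3) = a := ENNReal.mul_div_cancel (by simp) (by simp)
    have := h f hf (a / 3) (by simp [ha0]) (ENNReal.div_ne_top hat (by simp))
    rw [h3] at this
    calc a * volume {x | a < maximalTruncation K f x}
        = 3 * (a / 3 * volume {x | a < maximalTruncation K f x}) := by rw [← mul_assoc, h3]
      _ ≤ 3 * ((C₁ * D + V * C₃ + 2 * C₂ : ℝ≥0) * ∫⁻ x, ‖f x‖ₑ) := by gcongr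
      _ = _ := by rw [ENNReal.coe_mul 3, ENNReal.coe_ofNat]; exact (mul_assoc _ _ _).symm
  intro f hf a ha0 hat
  set N := ∫⁻ x, ‖f x‖ₑ with hN
  have hNtop : N ≠ ∞ := hf.hasFiniteIntegral.ne
  let Ω := {x | a < maximalFn (fun y => ‖f y‖ₑ) x}
  have hΩopen : IsOpen Ω := isOpen_lt_maximalFn _ a
  have hΩ : a * volume Ω ≤ C₃ * N := hC₃ _ a
  have hΩtop : volume Ω ≠ ∞ := by
    intro h
    rw [h, ENNReal.mul_top ha0, top_le_iff] at hΩ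
    exact ENNReal.mul_ne_top ENNReal.coe_ne_top hNtop hΩ
  let J := maximalCubes Ω
  have hJ : J.PairwiseDisjoint cube := pairwiseDisjoint_maximalCubes Ω
  have hJΩ : ⋃ i ∈ J, cube i = Ω := biUnion_maximalCubes hn hΩtop fun x hx =>
    (exists_cube_subset_of_isOpen hΩopen hx 0).imp fun _ h => h.2
  let g := goodPart f J
  let b := fun x => f x - g x
  have hg : Integrable g := integrable_goodPart hf hJ
  have hb : Integrable b := hf.sub hg
  have hgN : ∫⁻ x, ‖g x‖ₑ ≤ N := lintegral_goodPart_le hJ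
  have hbN : ∫⁻ x, ‖b x‖ₑ ≤ 2 * N := by
    calc ∫⁻ x, ‖b x‖ₑ ≤ ∫⁻ x, (‖f x‖ₑ + ‖g x‖ₑ) := lintegral_mono fun x => enorm_sub_le
      _ = N + ∫⁻ x, ‖g x‖ₑ := lintegral_add_left' hf.aestronglyMeasurable.enorm _
      _ ≤ N + N := by gcongr
      _ = 2 * N := (two_mul N).symm
  have hgB : ∀ᵐ x ∂(volume : Measure (RSpace n)), ‖g x‖ₑ ≤ D * a := by
    refine ae_enorm_goodPart_le hJ (fun i hi => (setLIntegral_maximalCube_le hi).trans ?_) ?_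
    · gcongr
      simp only [D, ENNReal.coe_add, ENNReal.coe_pow]
      exact le_self_add
    · filter_upwards [hC₄ _ hf.aestronglyMeasurable.enorm hNtop] with x hx hxΩ
      rw [hJΩ] at hxΩ
      refine hx.trans (mul_le_mul' ?_ (not_lt.1 hxΩ))
      simp only [D, ENNReal.coe_add]
      exact le_add_self
  obtain ⟨hg2, hgmem⟩ := memLp_two_of_ae_bound hg (ENNReal.mul_ne_top ENNReal.coe_ne_top hat) hgB
  have hgood : a * volume {x | a < maximalTruncation K g x} ≤ C₁ * D * N := by
    rw [← ENNReal.mul_le_mul_iff_right ha0 hat]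
    calc a * (a * volume {x | a < maximalTruncation K g x})
        = a ^ 2 * volume {x | a < maximalTruncation K g x} := by ring
      _ ≤ C₁ * (D * a * N) := (hC₁ g hg hgmem a).trans (by gcongr; exact hg2.trans (by gcongr))
      _ = _ := by ring
  set W := ⋃ i ∈ J, Metric.ball (corner i) (4 * (√n * side i.1))
  have hWvol : a * volume W ≤ V * C₃ * N := by
    calc a * volume W ≤ a * (V * volume Ω) := by
          gcongr
          refine (volume_biUnion_ball_le hn hJ).trans_eq ?_
          rw [hJΩ]
          simp only [V, ENNReal.coe_mul, ENNReal.coe_pow, ENNReal.coe_toNNReal unitVol_ne_top]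
          rfl
      _ = V * (a * volume Ω) := by ring
      _ ≤ V * (C₃ * N) := by gcongr
      _ = _ := by ring
  have hbad : a * volume ({x | 2 * a < maximalTruncation K b x} \ W) ≤ 2 * C₂ * N := by
    refine (hC₂ b J a hb hJ (fun y hy => ?_) fun i hi => setIntegral_sub_goodPart hf hJ hi).trans ?_
    · simp only [b, g, goodPart_of_notMem hy, sub_self]
    · calc _ ≤ C₂ * (2 * N) := by gcongr
        _ = _ := by ring
  have hsub : {x | 3 * a < maximalTruncation K f x} ⊆ {x | a < maximalTruncation K g x} ∪
      (W ∪ ({x | 2 * a < maximalTruncation K b x} \ W)) := by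
    intro x hx
    have hx' : 3 * a < maximalTruncation K f x := hx
    rw [union_sdiff_self]
    by_contra hcon
    simp only [mem_union, mem_ofPred_eq, not_or, not_lt] at hcon
    refine hx'.not_ge ?_
    have e : f = fun y => g y + b y := by ext y; simp [b]
    calc maximalTruncation K f x ≤ maximalTruncation K g x + maximalTruncation K b x := by
          conv_lhs => rw [e]
          exact hK.maximalTruncation_add_le hg.locallyIntegrable hb.locallyIntegrable x
      _ ≤ a + 2 * a := add_le_add hcon.1 hcon.2.2
      _ = 3 * a := by ring
  calc a * volume {x | 3 * a < maximalTruncation K f x}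
      ≤ a * (volume {x | a < maximalTruncation K g x} + (volume W +
          volume ({x | 2 * a < maximalTruncation K b x} \ W))) := by
        gcongr
        refine (measure_mono hsub).trans ((measure_union_le _ _).trans ?_)
        gcongr
        exact measure_union_le _ _
    _ ≤ C₁ * D * N + (V * C₃ * N + 2 * C₂ * N) := by
        rw [mul_add, mul_add]
        gcongr
    _ = _ := by push_cast; ring

end WeakType

/-! ### Stopping cubes -/

/-- The average of `|f|` over the triple of a base cube. -/
noncomputable def tripleAverage (f : RSpace n → 𝕜) (i : DyadicIndex n) : ℝ≥0∞ :=
  ⨍⁻ y in triple i, ‖f y‖ₑ ∂volume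

/-- The exceptional set of a cube `Q`: the points of `Q` at which `T_♮` or the maximal function of
`f 1_{3Q}` exceeds `L` times the average of `|f|` over `3Q`. -/
def exceptionalSet (K : RSpace n → RSpace n → 𝕜) (L : ℝ≥0) (f : RSpace n → 𝕜)
    (i : DyadicIndex n) : Set (RSpace n) :=
  cube i ∩ ({x | L * tripleAverage f i < maximalTruncation K ((triple i).indicator f) x} ∪
    {x | L * tripleAverage f i < maximalFn (fun y => ‖(triple i).indicator f y‖ₑ) x})

/-- `j` is a stopping child of `i`: a maximal cube in the exceptional set of `i`. -/
def IsChild (K : RSpace n → RSpace n → 𝕜) (L : ℝ≥0) (f : RSpace n → 𝕜)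
    (i j : DyadicIndex n) : Prop := j ∈ maximalCubes (exceptionalSet K L f i)

/-- All cubes obtained from the base cubes of generation `k` by iterating the stopping rule. -/
def stoppingFamily (K : RSpace n → RSpace n → 𝕜) (L : ℝ≥0) (f : RSpace n → 𝕜) (k : ℤ) :
    Set (DyadicIndex n) :=
  {i | ∃ q : DyadicIndex n, q.1 = k ∧ Relation.ReflTransGen (IsChild K L f) q i}

section Average

variable {f : RSpace n → 𝕜}

lemma volume_mul_tripleAverage (f : RSpace n → 𝕜) (i : DyadicIndex n) :
    volume (triple i) * tripleAverage f i = ∫⁻ y in triple i, ‖f y‖ₑ :=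
  measure_mul_setLAverage _ (volume_triple_ne_top i)

lemma isBounded_triple (i : DyadicIndex n) : Bornology.IsBounded (triple i) :=
  (Metric.isBounded_closedBall (x := corner i) (r := √n * (2 * side i.1))).subset fun _ hy =>
    mem_closedBall_iff_norm'.2 (norm_sub_le_of_mem_triple (corner_mem i) hy)

lemma integrable_indicator_triple (hf : LocallyIntegrable f volume) (i : DyadicIndex n) :
    Integrable ((triple i).indicator f) :=
  ((hf.integrableOn_isCompact (isBounded_triple i).isCompact_closure).mono_set
    subset_closure).integrable_indicator (measurableSet_triple i)

lemma lintegral_indicator_triple (f : RSpace n → 𝕜) (i : DyadicIndex n) :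
    ∫⁻ y, ‖(triple i).indicator f y‖ₑ = volume (triple i) * tripleAverage f i := by
  rw [volume_mul_tripleAverage, ← lintegral_indicator (measurableSet_triple i)]
  simp only [enorm_indicator_eq_indicator_enorm]

lemma tripleAverage_ne_top (hf : LocallyIntegrable f volume) (i : DyadicIndex n) :
    tripleAverage f i ≠ ∞ := by
  have h : volume (triple i) * tripleAverage f i ≠ ∞ := by
    rw [← lintegral_indicator_triple]
    exact (integrable_indicator_triple hf i).hasFiniteIntegral.ne
  exact fun h' => h (by rw [h', ENNReal.mul_top (volume_triple_pos i)])

end Average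

section Stopping

variable {K : RSpace n → RSpace n → 𝕜} {A δ : ℝ}
  {T : Lp 𝕜 2 (volume : Measure (RSpace n)) →L[𝕜] Lp 𝕜 2 (volume : Measure (RSpace n))}

lemma maximalFn_zero (x : RSpace n) : maximalFn (fun _ => 0) x = 0 := by
  simp [maximalFn]

lemma maximalTruncation_zero (x : RSpace n) : maximalTruncation K (fun _ => 0) x = 0 := by
  simp [maximalTruncation]

/-- The weak type `(1, 1)` estimates make the exceptional sets small. -/
lemma exists_volume_exceptionalSet_le (hn : 1 ≤ n) (hT : IsCalderonZygmund T K)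
    (hK : KernelBounds K A δ) : ∃ L : ℝ≥0, ∀ f : RSpace n → 𝕜, LocallyIntegrable f volume →
      ∀ i, 2 * volume (exceptionalSet K L f i) ≤ volume (cube i) := by
  obtain ⟨C₁, hC₁⟩ := exists_maximalTruncation_weak_one hn hT hK
  obtain ⟨C₂, hC₂⟩ := exists_maximalFn_weak hn
  let B : ℝ≥0 := (C₁ + C₂) * 3 ^ n + 1
  have hB0 : (B : ℝ≥0∞) ≠ 0 := by simp [B]
  refine ⟨2 * B, fun f hf i => ?_⟩
  -- The weak type estimates say nothing at level zero, but then `f` vanishes on the triple.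
  rcases eq_or_ne (tripleAverage f i) 0 with h0 | h0
  · have hae : (triple i).indicator f =ᵐ[volume] fun _ => 0 := by
      have h := lintegral_indicator_triple f i
      rw [h0, mul_zero, lintegral_eq_zero_iff'
        (integrable_indicator_triple hf i).aestronglyMeasurable.enorm] at h
      filter_upwards [h] with x hx
      simpa using hx
    have hae' : (fun y => ‖(triple i).indicator f y‖ₑ) =ᵐ[volume] fun _ => 0 := by
      filter_upwards [hae] with x hx
      simp [hx]
    have : exceptionalSet K (2 * B) f i = ∅ := by
      refine eq_empty_of_forall_notMem fun x hx => ?_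
      rcases hx.2 with h | h
      · rw [mem_ofPred_eq, maximalTruncation_congr hae, maximalTruncation_zero] at h
        exact not_lt_zero h
      · rw [mem_ofPred_eq, maximalFn_congr hae', maximalFn_zero] at h
        exact not_lt_zero h
    simp [this]
  have htop := tripleAverage_ne_top hf i
  set a := tripleAverage f i with ha
  set E := exceptionalSet K (2 * B) f i
  have h1 : (2 * B : ℝ≥0) * a * volume E ≤ (C₁ + C₂) * (3 ^ n * volume (cube i) * a) := by
    rw [← volume_triple, ← lintegral_indicator_triple, add_mul]
    refine (mul_le_mul_right ((measure_mono inter_subset_right).trans (measure_union_le _ _))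
      _).trans ?_
    rw [mul_add]
    exact add_le_add (hC₁ _ (integrable_indicator_triple hf i) _) (hC₂ _ _)
  have hBa0 : (B : ℝ≥0∞) * a ≠ 0 := mul_ne_zero hB0 h0
  have hBat : (B : ℝ≥0∞) * a ≠ ∞ := ENNReal.mul_ne_top ENNReal.coe_ne_top htop
  rw [← ENNReal.mul_le_mul_iff_right hBa0 hBat]
  calc B * a * (2 * volume E) = (2 * B : ℝ≥0) * a * volume E := by push_cast; ring
    _ ≤ (C₁ + C₂) * (3 ^ n * volume (cube i) * a) := h1
    _ = ((C₁ + C₂) * 3 ^ n) * a * volume (cube i) := by ring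
    _ ≤ B * a * volume (cube i) := by
        gcongr
        simp only [B, ENNReal.coe_add, ENNReal.coe_mul, ENNReal.coe_pow, ENNReal.coe_ofNat]
        exact le_self_add

/-- A threshold for the stopping rule for which all exceptional sets of `f` are small. -/
def IsThreshold (K : RSpace n → RSpace n → 𝕜) (L : ℝ≥0) (f : RSpace n → 𝕜) : Prop :=
  ∀ i, 2 * volume (exceptionalSet K L f i) ≤ volume (cube i)

variable {L : ℝ≥0} {f : RSpace n → 𝕜}

lemma exceptionalSet_subset_cube (i : DyadicIndex n) : exceptionalSet K L f i ⊆ cube i :=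
  inter_subset_left

lemma IsThreshold.not_cube_subset (hL : IsThreshold K L f) (i : DyadicIndex n) :
    ¬ cube i ⊆ exceptionalSet K L f i := by
  intro h
  have h1 := hL i
  rw [h.antisymm' (exceptionalSet_subset_cube i)] at h1
  have h2 : volume (cube i) < 2 * volume (cube i) := by
    rw [two_mul]
    exact ENNReal.lt_add_right (volume_cube_ne_top i) (volume_cube_pos i)
  exact h2.not_ge h1

lemma IsChild.cube_subset {i j : DyadicIndex n} (h : IsChild K L f i j) :
    cube j ⊆ exceptionalSet K L f i := h.1

lemma IsChild.lt (hL : IsThreshold K L f) {i j : DyadicIndex n} (h : IsChild K L f i j) :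
    j.1 < i.1 := by
  by_contra! hle
  have hc := corner_mem j
  exact hL.not_cube_subset i ((cube_subset_of_le hle
    (exceptionalSet_subset_cube i (h.cube_subset hc)) hc).trans h.cube_subset)

lemma isOpen_exceptional (hK : KernelBounds K A δ) (hf : LocallyIntegrable f volume)
    (i : DyadicIndex n) : IsOpen
    ({x | L * tripleAverage f i < maximalTruncation K ((triple i).indicator f) x} ∪
    {x | L * tripleAverage f i < maximalFn (fun y => ‖(triple i).indicator f y‖ₑ) x}) :=
  (hK.isOpen_lt_maximalTruncation (integrable_indicator_triple hf i).locallyIntegrable _).union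
    (isOpen_lt_maximalFn _ _)

lemma measurableSet_exceptionalSet (hK : KernelBounds K A δ) (hf : LocallyIntegrable f volume)
    (i : DyadicIndex n) : MeasurableSet (exceptionalSet K L f i) :=
  (measurableSet_cube i).inter (isOpen_exceptional hK hf i).measurableSet

lemma exists_isChild (hn : 1 ≤ n) (hK : KernelBounds K A δ) (hf : LocallyIntegrable f volume)
    {i : DyadicIndex n} {x : RSpace n} (hx : x ∈ exceptionalSet K L f i) :
    ∃ j, IsChild K L f i j ∧ x ∈ cube j := by
  have hfin : volume (exceptionalSet K L f i) ≠ ∞ :=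
    measure_ne_top_of_subset (exceptionalSet_subset_cube i) (volume_cube_ne_top i)
  have h := biUnion_maximalCubes hn hfin fun y hy => by
    obtain ⟨k, hk, hsub⟩ := exists_cube_subset_of_isOpen (isOpen_exceptional hK hf i) hy.2 i.1
    exact ⟨k, subset_inter (cube_subset_of_le hk (mem_cube_indexAt k y) hy.1) hsub⟩
  rw [← h] at hx
  obtain ⟨j, hj, hxj⟩ := mem_iUnion₂.1 hx
  exact ⟨j, hj, hxj⟩

/-- One step of the stopping construction: the parent of a stopping child contains a point at which
`T_♮` and the maximal function are small, and this controls the part of `f` far from the child. -/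
lemma exists_maximalTruncation_child_le (hK : KernelBounds K A δ) (hn : 1 ≤ n) : ∃ C : ℝ≥0,
    ∀ (L : ℝ≥0) (f : RSpace n → 𝕜) (i j : DyadicIndex n) (x : RSpace n),
      LocallyIntegrable f volume → IsThreshold K L f → IsChild K L f i j → x ∈ cube j →
      maximalTruncation K ((triple i).indicator f) x ≤
        (L + C * L) * tripleAverage f i + maximalTruncation K ((triple j).indicator f) x := by
  have hn0 : (0 : ℝ) < n := by exact_mod_cast hn
  obtain ⟨C, hC⟩ := hK.exists_maximalTruncation_far_le (κ := 2 * √n) (by positivity)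
  refine ⟨C, fun L f i j x hf hL hj hx => ?_⟩
  have hlt := hj.lt hL
  have hji : cube j ⊆ cube i := hj.cube_subset.trans (exceptionalSet_subset_cube i)
  obtain ⟨x₀, hx₀, hx₀E⟩ := not_subset.1 hj.2
  have hx₀i : x₀ ∈ cube i := cube_subset_of_le (Int.add_one_le_iff.2 hlt)
    (cube_subset_parent j hx) (hji hx) hx₀
  have hx₀' : ¬ _ := fun h => hx₀E ⟨hx₀i, h⟩
  simp only [mem_union, mem_ofPred_eq, not_or, not_lt] at hx₀'
  have htri := triple_subset_of_cube_subset hlt.le hji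
  have hI := (integrable_indicator_triple hf i).locallyIntegrable
  have hsplit : (triple i).indicator f = fun y => (triple j).indicator f y +
      (triple j)ᶜ.indicator ((triple i).indicator f) y := by
    ext y
    by_cases hy : y ∈ triple j
    · simp [hy, htri hy]
    · simp [hy]
  have hfar := hC ((triple i).indicator f) (triple j) x x₀ (side j.1) hI (measurableSet_triple j)
    (side_pos _) (norm_sub_le_of_mem_parent hx₀ hx)
    (fun y hy => not_lt.1 fun h => hy (mem_triple_of_norm_lt hx h))
    (fun y hy => (norm_sub_le_of_mem_triple hx hy).trans_eq (by ring))
  have hadd := hK.maximalTruncation_add_le (integrable_indicator_triple hf j).locallyIntegrable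
    ((integrable_indicator_triple hf i).indicator (measurableSet_triple j).compl).locallyIntegrable
    x
  rw [← hsplit] at hadd
  refine hadd.trans ?_
  rw [add_comm]
  gcongr
  refine hfar.trans ?_
  rw [add_mul, mul_assoc]
  gcongr
  · exact hx₀'.1
  · exact hx₀'.2

/-! ### Sparseness of the stopping family -/

lemma cube_subset_of_reflTransGen (hL : IsThreshold K L f) {i j : DyadicIndex n}
    (h : Relation.ReflTransGen (IsChild K L f) i j) : cube j ⊆ cube i ∧ j.1 ≤ i.1 := by
  induction h with
  | refl => exact ⟨Subset.rfl, le_rfl⟩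
  | tail _ hbc ih =>
    exact ⟨(hbc.cube_subset.trans (exceptionalSet_subset_cube _)).trans ih.1,
      (hbc.lt hL).le.trans ih.2⟩

/-- Two intersecting cubes of the stopping family descend from one another. -/
lemma reflTransGen_total (hL : IsThreshold K L f) {q i j : DyadicIndex n}
    (hi : Relation.ReflTransGen (IsChild K L f) q i)
    (hj : Relation.ReflTransGen (IsChild K L f) q j) {x : RSpace n} (hxi : x ∈ cube i)
    (hxj : x ∈ cube j) : Relation.ReflTransGen (IsChild K L f) i j ∨
      Relation.ReflTransGen (IsChild K L f) j i := by
  induction hi using Relation.ReflTransGen.head_induction_on with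
  | refl => exact .inl hj
  | head hab hbi ih =>
    rcases hj.cases_head with rfl | ⟨c, hac, hcj⟩
    · exact .inr (.head hab hbi)
    · have := eq_of_mem_maximalCubes hab hac ((cube_subset_of_reflTransGen hL hbi).1 hxi)
        ((cube_subset_of_reflTransGen hL hcj).1 hxj)
      subst this
      exact ih hcj

lemma disjoint_of_reflTransGen (hL : IsThreshold K L f) {i j : DyadicIndex n}
    (h : Relation.ReflTransGen (IsChild K L f) i j) (hij : i ≠ j) :
    Disjoint (cube i \ exceptionalSet K L f i) (cube j) := by
  rcases h.cases_head with rfl | ⟨c, hic, hcj⟩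
  · exact (hij rfl).elim
  · rw [disjoint_left]
    exact fun x hx hxj => hx.2 (hic.cube_subset ((cube_subset_of_reflTransGen hL hcj).1 hxj))

lemma pairwiseDisjoint_stoppingFamily (hL : IsThreshold K L f) (k : ℤ) :
    (stoppingFamily K L f k).PairwiseDisjoint fun i => cube i \ exceptionalSet K L f i := by
  rintro i ⟨q, hq, hi⟩ j ⟨p, hp, hj⟩ hij
  rw [Function.onFun, disjoint_left]
  intro x hxi hxj
  have hqp : q = p := eq_of_mem_cube (hq.trans hp.symm)
    ((cube_subset_of_reflTransGen hL hi).1 hxi.1) ((cube_subset_of_reflTransGen hL hj).1 hxj.1)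
  subst hqp
  rcases reflTransGen_total hL hi hj hxi.1 hxj.1 with h | h
  · exact disjoint_left.1 (disjoint_of_reflTransGen hL h hij) hxi hxj.1
  · exact disjoint_left.1 (disjoint_of_reflTransGen hL h hij.symm) hxj hxi.1

/-- The Carleson packing condition for the stopping family. -/
lemma tsum_volume_stoppingFamily_le (hK : KernelBounds K A δ) (hf : LocallyIntegrable f volume)
    (hL : IsThreshold K L f) (k : ℤ) {G : Set (DyadicIndex n)} (hG : G ⊆ stoppingFamily K L f k)
    {R : Set (RSpace n)} (hR : ∀ i ∈ G, cube i ⊆ R) :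
    ∑' i : G, volume (cube i.1) ≤ 2 * volume R := by
  have hmeas : ∀ i ∈ G, MeasurableSet (cube i \ exceptionalSet K L f i) := fun i _ =>
    (measurableSet_cube i).diff (measurableSet_exceptionalSet hK hf i)
  have hhalf : ∀ i : G, volume (cube i.1) ≤ 2 * volume (cube i.1 \ exceptionalSet K L f i.1) := by
    intro i
    have h1 : volume (cube i.1) ≤ volume (cube i.1 \ exceptionalSet K L f i.1) +
        volume (exceptionalSet K L f i.1) := by
      refine (measure_mono ?_).trans (measure_union_le _ _)
      rw [sdiff_union_self]
      exact subset_union_left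
    have h2 : volume (cube i.1) + volume (cube i.1) ≤
        2 * volume (cube i.1 \ exceptionalSet K L f i.1) + volume (cube i.1) := by
      calc volume (cube i.1) + volume (cube i.1) ≤ 2 * (volume (cube i.1 \
            exceptionalSet K L f i.1) + volume (exceptionalSet K L f i.1)) := by
            rw [two_mul]; gcongr
        _ ≤ _ := by rw [mul_add]; gcongr; exact hL i.1
    exact (ENNReal.add_le_add_iff_right (volume_cube_ne_top i.1)).1 h2
  calc ∑' i : G, volume (cube i.1)
      ≤ ∑' i : G, 2 * volume (cube i.1 \ exceptionalSet K L f i.1) := ENNReal.tsum_le_tsum hhalf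
    _ = 2 * volume (⋃ i ∈ G, (cube i \ exceptionalSet K L f i)) := by
        rw [ENNReal.tsum_mul_left, measure_biUnion G.to_countable
          ((pairwiseDisjoint_stoppingFamily hL k).subset hG) hmeas]
    _ ≤ 2 * volume R := by
        gcongr
        exact iUnion₂_subset fun i hi => sdiff_subset.trans (hR i hi)

/-- By the Borel–Cantelli lemma, almost every point lies in finitely many stopping cubes. -/
lemma ae_finite_stoppingFamily (hK : KernelBounds K A δ) (hf : LocallyIntegrable f volume)
    (hL : IsThreshold K L f) (k : ℤ) : ∀ᵐ x ∂(volume : Measure (RSpace n)),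
      {i | i ∈ stoppingFamily K L f k ∧ x ∈ cube i}.Finite := by
  have h : ∀ q : DyadicIndex n, ∀ᵐ x ∂(volume : Measure (RSpace n)),
      {i : {i | i ∈ stoppingFamily K L f k ∧ cube i ⊆ cube q} | x ∈ cube i.1}.Finite := by
    intro q
    refine ae_finite_setOfPred_mem (ne_top_of_le_ne_top ?_
      (tsum_volume_stoppingFamily_le hK hf hL k (fun i hi => hi.1) fun i hi => hi.2))
    exact ENNReal.mul_ne_top (by simp) (volume_cube_ne_top q)
  filter_upwards [ae_all_iff.2 h] with x hx
  refine ((hx (indexAt k x)).image Subtype.val).subset ?_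
  rintro i ⟨⟨q, hq, hi⟩, hxi⟩
  have hsub := (cube_subset_of_reflTransGen hL hi).1
  have hqx : q = indexAt k x := eq_of_mem_cube hq (hsub hxi) (mem_cube_indexAt k x)
  subst hqx
  exact ⟨⟨i, ⟨_, hq, hi⟩, hsub⟩, hxi, rfl⟩

lemma stoppingFamily_le (hL : IsThreshold K L f) {k : ℤ} {i : DyadicIndex n}
    (hi : i ∈ stoppingFamily K L f k) : i.1 ≤ k := by
  obtain ⟨q, rfl, h⟩ := hi
  exact (cube_subset_of_reflTransGen hL h).2

/-- Pointwise domination by the averages over the triples of the stopping cubes. -/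
lemma exists_ae_maximalTruncation_le (hn : 1 ≤ n) (hT : IsCalderonZygmund T K)
    (hK : KernelBounds K A δ) : ∃ L C : ℝ≥0, ∀ (f : RSpace n → 𝕜),
      LocallyIntegrable f volume → IsThreshold K L f ∧ ∀ k : ℤ,
        ∀ᵐ x ∂(volume : Measure (RSpace n)),
          maximalTruncation K ((triple (indexAt k x)).indicator f) x ≤
            C * ∑' i : stoppingFamily K L f k, (cube i.1).indicator
              (fun _ => tripleAverage f i.1) x := by
  obtain ⟨L, hL⟩ := exists_volume_exceptionalSet_le hn hT hK
  obtain ⟨C, hC⟩ := exists_maximalTruncation_child_le hK hn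
  refine ⟨L, L + C * L, fun f hf => ⟨hL f hf, fun k => ?_⟩⟩
  have hLf : IsThreshold K L f := hL f hf
  filter_upwards [ae_finite_stoppingFamily hK hf hLf k] with x hx
  set F := stoppingFamily K L f k with hF
  obtain ⟨m, hm⟩ := (hx.image Prod.fst).bddBelow
  let h : DyadicIndex n → ℝ≥0∞ := fun i => (cube i).indicator (fun _ => tripleAverage f i) x
  -- The claim is proved for all stopping cubes containing `x`, starting with the smallest one.
  have key : ∀ N : ℕ, ∀ i ∈ F, x ∈ cube i → i.1 < m + N →
      maximalTruncation K ((triple i).indicator f) x ≤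
        (L + C * L : ℝ≥0) * ∑' j : {j | j ∈ F ∧ j.1 ≤ i.1}, h j := by
    intro N
    induction N with
    | zero =>
      intro i hi hxi hlt
      have := hm (mem_image_of_mem Prod.fst (show i ∈ {i | i ∈ F ∧ x ∈ cube i} from ⟨hi, hxi⟩))
      simp at hlt
      lia
    | succ N ih =>
      intro i hi hxi hlt
      have hhi : h i = tripleAverage f i := indicator_of_mem hxi _
      by_cases hxE : x ∈ exceptionalSet K L f i
      · obtain ⟨j, hij, hxj⟩ := exists_isChild hn hK hf hxE
        have hjF : j ∈ F := by
          obtain ⟨q, hq, hqi⟩ := hi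
          exact ⟨q, hq, hqi.tail hij⟩
        have hji := hij.lt hLf
        have hsum : h i + ∑' l : {l | l ∈ F ∧ l.1 ≤ j.1}, h l ≤
            ∑' l : {l | l ∈ F ∧ l.1 ≤ i.1}, h l := by
          have hd : Disjoint {i} {l | l ∈ F ∧ l.1 ≤ j.1} :=
            disjoint_singleton_left.2 fun hmem => hji.not_ge hmem.2
          rw [← tsum_singleton i h, ← ENNReal.summable.tsum_union_disjoint hd ENNReal.summable]
          refine ENNReal.tsum_mono_subtype h ?_
          rintro l (rfl | hl)
          · exact ⟨hi, le_rfl⟩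
          · exact ⟨hl.1, hl.2.trans hji.le⟩
        calc maximalTruncation K ((triple i).indicator f) x
            ≤ (L + C * L) * tripleAverage f i +
                maximalTruncation K ((triple j).indicator f) x := hC L f i j x hf hLf hij hxj
          _ ≤ (L + C * L : ℝ≥0) * h i +
                (L + C * L : ℝ≥0) * ∑' l : {l | l ∈ F ∧ l.1 ≤ j.1}, h l := by
              refine add_le_add ?_ (ih j hjF hxj (by push_cast at hlt; lia))
              rw [hhi]; push_cast; rfl
          _ ≤ _ := by rw [← mul_add]; gcongr
      · have hx' : ¬ _ := fun h => hxE ⟨hxi, h⟩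
        simp only [mem_union, mem_ofPred_eq, not_or, not_lt] at hx'
        refine hx'.1.trans ?_
        rw [← hhi]
        gcongr
        · exact le_self_add
        · exact ENNReal.le_tsum (f := fun j : {j | j ∈ F ∧ j.1 ≤ i.1} => h j) ⟨i, hi, le_rfl⟩
  have hroot : indexAt k x ∈ F := ⟨_, rfl, .refl⟩
  have hN : (indexAt k x).1 < m + ((indexAt k x).1 - m + 1).toNat := by
    have := hm (mem_image_of_mem Prod.fst
      (show indexAt k x ∈ {i | i ∈ F ∧ x ∈ cube i} from ⟨hroot, mem_cube_indexAt k x⟩))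
    lia
  refine (key _ _ hroot (mem_cube_indexAt k x) hN).trans ?_
  gcongr
  exact ENNReal.tsum_mono_subtype h fun l hl => hl.1

end Stopping

/-! ### Domination by sparse operators -/

section Sparse

variable {K : RSpace n → RSpace n → 𝕜} {A δ : ℝ} {L : ℝ≥0} {f : RSpace n → 𝕜}

/-- The triples of the stopping cubes that belong to the grid of the residue class `j`. -/
def stoppingTriples (K : RSpace n → RSpace n → 𝕜) (L : ℝ≥0) (f : RSpace n → 𝕜) (k : ℤ)
    (j : Fin n → Fin 3) : Set (Set (RSpace n)) :=
  triple '' (stoppingFamily K L f k ∩ residueClass j)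

lemma stoppingTriples_subset_grid (k : ℤ) (j : Fin n → Fin 3) :
    stoppingTriples K L f k j ⊆ grid j := image_mono inter_subset_right

lemma finite_strictAncestors_stoppingTriples (hn : 1 ≤ n) (hL : IsThreshold K L f) (k : ℤ)
    (j : Fin n → Fin 3) {R : Set (RSpace n)} (hR : R ∈ stoppingTriples K L f k j) :
    (strictAncestors (stoppingTriples K L f k j) R).Finite := by
  obtain ⟨i, hi, rfl⟩ := hR
  have hlt : ∀ l ∈ residueClass j, triple i ⊂ triple l → i.1 < l.1 := by
    intro l hl h
    by_contra! hle
    obtain ⟨x, hx⟩ := triple_nonempty i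
    exact h.2 (triple_subset_of_mem hl hi.2 hle (h.1 hx) hx)
  have hfin : {l | l ∈ stoppingFamily K L f k ∩ residueClass j ∧ triple i ⊂ triple l}.Finite := by
    refine Finite.of_finite_image (f := Prod.fst) ((finite_Icc i.1 k).subset ?_) ?_
    · rintro _ ⟨l, ⟨hl, hil⟩, rfl⟩
      exact ⟨(hlt l hl.2 hil).le, stoppingFamily_le hL hl.1⟩
    · rintro l ⟨hl, hil⟩ l' ⟨hl', hil'⟩ h
      obtain ⟨x, hx⟩ := triple_nonempty i
      exact triple_injective hn (subset_antisymm
        (triple_subset_of_mem hl.2 hl'.2 h.le (hil.1 hx) (hil'.1 hx))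
        (triple_subset_of_mem hl'.2 hl.2 h.ge (hil'.1 hx) (hil.1 hx)))
  refine (hfin.image triple).subset ?_
  rintro _ ⟨⟨l, hl, rfl⟩, hil⟩
  exact ⟨l, ⟨hl, hil⟩, rfl⟩

lemma tsum_volume_stoppingTriples_le (hn : 1 ≤ n) (hK : KernelBounds K A δ)
    (hf : LocallyIntegrable f volume) (hL : IsThreshold K L f) (k : ℤ) (j : Fin n → Fin 3)
    (R : Set (RSpace n)) :
    2 * ∑' P : {P | P ∈ stoppingTriples K L f k j ∧ P ⊆ R}, volume (P : Set (RSpace n)) ≤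
      (4 * 3 ^ n : ℕ) * volume R := by
  have hset : {P | P ∈ stoppingTriples K L f k j ∧ P ⊆ R} =
      triple '' {i | i ∈ stoppingFamily K L f k ∩ residueClass j ∧ triple i ⊆ R} := by
    ext P
    constructor
    · rintro ⟨⟨i, hi, rfl⟩, h⟩
      exact ⟨i, ⟨hi, h⟩, rfl⟩
    · rintro ⟨i, ⟨hi, h⟩, rfl⟩
      exact ⟨⟨i, hi, rfl⟩, h⟩
  rw [hset, tsum_image (fun P => volume P) (triple_injective hn).injOn]
  simp only [volume_triple]
  rw [ENNReal.tsum_mul_left]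
  calc _ ≤ 2 * (3 ^ n * (2 * volume R)) := by
        gcongr
        exact tsum_volume_stoppingFamily_le hK hf hL k (fun i hi => hi.1.1)
          fun i hi => (cube_subset_triple i).trans hi.2
    _ = _ := by push_cast; ring

lemma isSparseFamily_stoppingTriples (hn : 1 ≤ n) (hK : KernelBounds K A δ)
    (hf : LocallyIntegrable f volume) (hL : IsThreshold K L f) (k : ℤ) (j : Fin n → Fin 3)
    (r : ℕ) :
    IsSparseFamily (grid j) (levelClass (stoppingTriples K L f k j) (4 * 3 ^ n) r) := by
  refine isSparseFamily_levelClass (isDyadicGrid_grid hn j) (stoppingTriples_subset_grid k j)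
    ((to_countable _).image _) ?_ ?_ (by positivity)
    (fun R _ => tsum_volume_stoppingTriples_le hn hK hf hL k j R) r
  · rintro _ ⟨i, _, rfl⟩
    exact measurableSet_triple i
  · exact fun R hR => finite_strictAncestors_stoppingTriples hn hL k j hR

lemma measurable_sparseOperator_stoppingTriples (k : ℤ) (j : Fin n → Fin 3) (m r : ℕ)
    (g : RSpace n → ℝ≥0∞) :
    Measurable (sparseOperator (levelClass (stoppingTriples K L f k j) m r) g) := by
  refine measurable_sparseOperator (fun t => ?_) (fun t => ?_) g
  · exact (((to_countable _).image triple).mono fun R hR => hR.1)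
  · rintro _ ⟨⟨i, _, rfl⟩, _⟩
    exact measurableSet_triple i

lemma tsum_stoppingFamily_le_sum (hn : 1 ≤ n) (k : ℤ) (x : RSpace n) :
    ∑' i : stoppingFamily K L f k, (cube i.1).indicator (fun _ => tripleAverage f i.1) x ≤
      ∑ j : Fin n → Fin 3, ∑ r : Fin (4 * 3 ^ n),
        sparseOperator (levelClass (stoppingTriples K L f k j) (4 * 3 ^ n) r)
          (fun y => ‖f y‖ₑ) x := by
  let h : Set (RSpace n) → ℝ≥0∞ := fun R => R.indicator (fun _ => ⨍⁻ y in R, ‖f y‖ₑ ∂volume) x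
  calc ∑' i : stoppingFamily K L f k, (cube i.1).indicator (fun _ => tripleAverage f i.1) x
      ≤ ∑' i : stoppingFamily K L f k, h (triple i.1) := by
        refine ENNReal.tsum_le_tsum fun i => ?_
        exact indicator_le_indicator_of_subset (cube_subset_triple i.1) (fun _ => zero_le) x
    _ ≤ ∑' i : ⋃ j : Fin n → Fin 3, stoppingFamily K L f k ∩ residueClass j, h (triple i.1) := by
        refine ENNReal.tsum_mono_subtype (fun i => h (triple i)) fun i hi => ?_
        obtain ⟨j, hj⟩ := exists_mem_residueClass i
        exact mem_iUnion.2 ⟨j, hi, hj⟩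
    _ ≤ ∑ j : Fin n → Fin 3, ∑' i : ↥(stoppingFamily K L f k ∩ residueClass j), h (triple i.1) :=
        ENNReal.tsum_iUnion_le (fun i => h (triple i)) _
    _ = ∑ j : Fin n → Fin 3, ∑' R : stoppingTriples K L f k j, h R := by
        refine Finset.sum_congr rfl fun j _ => ?_
        exact (tsum_image h (triple_injective hn).injOn).symm
    _ ≤ _ := Finset.sum_le_sum fun j _ => tsum_le_sum_sparseOperator (by positivity) _ x

end Sparse

/-! ### Truncations of bounded range -/

/-- The maximal truncated operator with the outer radius restricted to `ν ≤ N`. -/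
noncomputable def boundedTruncation (K : RSpace n → RSpace n → 𝕜) (f : RSpace n → 𝕜) (N : ℕ)
    (x : RSpace n) : ℝ≥0∞ :=
  ⨆ (ε : ℝ) (ν : ℝ) (_ : 0 < ε) (_ : ε < ν) (_ : ν ≤ N), ‖∫ y in annulus x ε ν, K x y * f y‖ₑ

section Bounded

variable {K : RSpace n → RSpace n → 𝕜} {A δ : ℝ} {f : RSpace n → 𝕜}

lemma iSup_boundedTruncation (x : RSpace n) :
    ⨆ N, boundedTruncation K f N x = maximalTruncation K f x := by
  refine le_antisymm (iSup_le fun N => iSup_le fun ε => iSup_le fun ν => iSup_le fun hε =>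
    iSup_le fun hν => iSup_le fun _ => enorm_le_maximalTruncation K f x hε hν)
    (maximalTruncation_le fun ε ν hε hν => ?_)
  obtain ⟨N, hN⟩ := exists_nat_ge ν
  exact le_iSup_of_le N (le_iSup_of_le ε (le_iSup_of_le ν (le_iSup_of_le hε (le_iSup_of_le hν
    (le_iSup_of_le hN le_rfl)))))

lemma monotone_boundedTruncation (x : RSpace n) :
    Monotone fun N => boundedTruncation K f N x := by
  intro M N hMN
  refine iSup_le fun ε => iSup_le fun ν => iSup_le fun hε => iSup_le fun hν => iSup_le fun hM => ?_
  exact le_iSup_of_le ε (le_iSup_of_le ν (le_iSup_of_le hε (le_iSup_of_le hν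
    (le_iSup_of_le (hM.trans (by exact_mod_cast hMN)) le_rfl))))

lemma KernelBounds.measurable_boundedTruncation (hK : KernelBounds K A δ)
    (hf : LocallyIntegrable f volume) (N : ℕ) : Measurable (boundedTruncation K f N) := by
  refine LowerSemicontinuous.measurable ?_
  refine lowerSemicontinuous_iSup fun ε => lowerSemicontinuous_iSup fun ν =>
    lowerSemicontinuous_iSup fun hε => lowerSemicontinuous_iSup fun hν =>
    lowerSemicontinuous_iSup fun _ => ?_
  exact (hK.continuous_truncation hf hε hν).enorm.lowerSemicontinuous

/-- Truncations of range at most the sidelength of a cube only see `f` on the triple of the cube. -/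
lemma boundedTruncation_le_of_le_side {N : ℕ} {i : DyadicIndex n} (hN : N ≤ side i.1)
    {x : RSpace n} (hx : x ∈ cube i) :
    boundedTruncation K f N x ≤ maximalTruncation K ((triple i).indicator f) x := by
  refine iSup_le fun ε => iSup_le fun ν => iSup_le fun hε => iSup_le fun hν => iSup_le fun hνN => ?_
  refine le_trans (le_of_eq ?_) (enorm_le_maximalTruncation K _ x hε hν)
  congr 1
  refine setIntegral_congr_fun (measurableSet_annulus x ε ν) fun y hy => ?_
  have : y ∈ triple i := mem_triple_of_norm_lt hx (hy.2.trans_le (hνN.trans hN))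
  simp only [indicator_of_mem this]

end Bounded

lemma exists_nat_le_side (N : ℕ) : ∃ k : ℤ, (N : ℝ) ≤ side k := by
  obtain ⟨m, hm⟩ := pow_unbounded_of_one_lt (3 * N : ℝ) (one_lt_two : (1 : ℝ) < 2)
  refine ⟨m, ?_⟩
  simp only [side, zpow_natCast]
  linarith

/-! ### Banach function norms -/

lemma rho_sum_le {α : Type*} [MeasurableSpace α] {μ : Measure α} (X : BanachFunctionNorm μ)
    {ι : Type*} (s : Finset ι) {g : ι → α → ℝ≥0∞} (hg : ∀ i, Measurable (g i)) :
    X.rho (fun x => ∑ i ∈ s, g i x) ≤ ∑ i ∈ s, X.rho (g i) := by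
  classical
  induction s using Finset.induction_on with
  | empty =>
    simp only [Finset.sum_empty]
    exact ((X.eq_zero_iff _ measurable_const).2 (ae_eq_refl _)).le
  | insert a s ha ih =>
    simp only [Finset.sum_insert ha]
    exact (X.add_le _ _ (hg a) (Finset.measurable_sum s fun i _ => hg i)).trans (by gcongr)

end SparseDomination

open SparseDomination

theorem mainTheorem2 {𝕜 : Type*} [RCLike 𝕜] (n : ℕ) (hn : 1 ≤ n)
    (T : Lp 𝕜 2 (volume : Measure (RSpace n)) →L[𝕜] Lp 𝕜 2 (volume : Measure (RSpace n)))
    (K : RSpace n → RSpace n → 𝕜) (hT : IsCalderonZygmund T K) :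
    ∃ c : ℝ≥0, ∀ (μ : Measure (RSpace n)) [SigmaFinite μ], μ ≪ volume →
      ∀ (X : BanachFunctionNorm μ) (f : RSpace n → 𝕜), LocallyIntegrable f volume →
        X.rho (maximalTruncation K f) ≤
          c * ⨆ (D : Set (Set (RSpace n))) (S : ℕ → Set (Set (RSpace n)))
            (_ : IsDyadicGrid D) (_ : IsSparseFamily D S),
              X.rho (sparseOperator S fun x => ‖f x‖ₑ) := by
  obtain ⟨A, δ, hK⟩ := exists_kernelBounds hT
  obtain ⟨L, C, hC⟩ := exists_ae_maximalTruncation_le hn hT hK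
  refine ⟨C * (3 ^ n * (4 * 3 ^ n) : ℕ), fun μ _ hμ X f hf => ?_⟩
  obtain ⟨hL, hC⟩ := hC f hf
  have hfun : maximalTruncation K f = fun x => ⨆ N, boundedTruncation K f N x :=
    funext fun x => (iSup_boundedTruncation x).symm
  rw [hfun, X.iSup_eq _ (hK.measurable_boundedTruncation hf)
    (.of_forall fun x => monotone_boundedTruncation x)]
  refine iSup_le fun N => ?_
  obtain ⟨k, hk⟩ := exists_nat_le_side N
  let m := 4 * 3 ^ n
  let G : (Fin n → Fin 3) → Fin m → RSpace n → ℝ≥0∞ := fun j r =>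
    sparseOperator (levelClass (stoppingTriples K L f k j) m r) fun x => ‖f x‖ₑ
  have hG : ∀ j r, Measurable (G j r) := fun j r =>
    measurable_sparseOperator_stoppingTriples k j m r _
  have hGj : ∀ j, Measurable fun x => ∑ r, G j r x := fun j =>
    Finset.measurable_sum _ fun r _ => hG j r
  have hGs : Measurable fun x => ∑ j, ∑ r, G j r x := Finset.measurable_sum _ fun j _ => hGj j
  have hpt : ∀ᵐ x ∂μ, boundedTruncation K f N x ≤ C * ∑ j, ∑ r, G j r x := by
    filter_upwards [hμ.ae_le (hC k)] with x hx
    refine (boundedTruncation_le_of_le_side (i := indexAt k x) hk (mem_cube_indexAt k x)).trans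
      (hx.trans ?_)
    gcongr
    exact tsum_stoppingFamily_le_sum hn k x
  set M := ⨆ (D : Set (Set (RSpace n))) (S : ℕ → Set (Set (RSpace n)))
    (_ : IsDyadicGrid D) (_ : IsSparseFamily D S), X.rho (sparseOperator S fun x => ‖f x‖ₑ)
  have hM : ∀ j r, X.rho (G j r) ≤ M := fun j r =>
    le_iSup_of_le (grid j) (le_iSup_of_le _ (le_iSup_of_le (isDyadicGrid_grid hn j)
      (le_iSup_of_le (isSparseFamily_stoppingTriples hn hK hf hL k j r) le_rfl)))
  calc X.rho (boundedTruncation K f N)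
      ≤ X.rho fun x => C * ∑ j, ∑ r, G j r x :=
        X.mono _ _ (hK.measurable_boundedTruncation hf N) (hGs.const_mul _) hpt
    _ = C * X.rho fun x => ∑ j, ∑ r, G j r x := X.const_mul C _ hGs
    _ ≤ C * ∑ j : Fin n → Fin 3, ∑ _r : Fin m, M := by
        gcongr
        refine (rho_sum_le X _ hGj).trans (Finset.sum_le_sum fun j _ => ?_)
        exact (rho_sum_le X _ (hG j)).trans (Finset.sum_le_sum fun r _ => hM j r)
    _ = _ := by simp [m, mul_assoc]
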